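/- Let $n\ge 2$, let $\mathfrak g$ and $V$ be vector spaces over a field $\mathbb K$ of characteristic $0$, and put $W=\mathfrak g\oplus V$. For $m\ge 0$ let $C^m(W,W)=\mathrm{Hom}(\otimes^m(\wedge^{n-1}W)\wedge W,\,W)$, that is, $\mathrm{Hom}(W,W)$ for $m=0$ and $\mathrm{Hom}(\otimes^{m-1}(\wedge^{n-1}W)\otimes\wedge^nW,\,W)$ for $m\ge1$. For $P\in C^p(W,W)$ and $Q\in C^q(W,W)$ put $[P,Q]_{\rm nLie}=P\circ Q-(-1)^{pq}Q\circ P$, where, for $\mathfrak X_i=x_i^1\wedge\cdots\wedge x_i^{n-1}$, $$\begin{aligned}(P\circ Q)(\mathfrak X_1,\dots,\mathfrak X_{p+q},x)=&\sum_{k=1}^{p}(-1)^{(k-1)q}\sum_{\sigma\in S(k-1,q)}(-1)^\sigma\sum_{i=1}^{n-1}P\big(\mathfrak X_{\sigma(1)},\dots,\mathfrak X_{\sigma(k-1)},\\&\quad x_{k+q}^1\wedge\cdots\wedge Q(\mathfrak X_{\sigma(k)},\dots,\mathfrak X_{\sigma(k+q-1)},x^i_{k+q})\wedge\cdots\wedge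 x_{k+q}^{n-1},\mathfrak X_{k+q+1},\dots,\mathfrak X_{p+q},x\big)\\&+(-1)^{pq}\sum_{\sigma\in S(p,q)}(-1)^\sigma P\big(\mathfrak X_{\sigma(1)},\dots,\mathfrak X_{\sigma(p)},Q(\mathfrak X_{\sigma(p+1)},\dots,\mathfrak X_{\sigma(p+q)},x)\big)\end{aligned}$$ (in the first sum $Q(\dots)$ stands in place of $x^i_{k+q}$, and $S(a,b)$ is the set of $(a,b)$-shuffles). Let $C^{k(n-1)|0}(W,W)\subseteq C^k(W,W)$ be the subspace of those $f$ which take values in $\mathfrak g$ on arguments all of whose $k(n-1)+1$ vectors lie in $\mathfrak g$, take values in $V$ if exactly one of these vectors lies in $V$ and the others in $\mathfrak g$, and vanish if at least two of them lie in $V$ and the others in $\mathfrak g$. Then $(\bigoplus_{k\ge0}C^k(W,W),[-,-]_{\rm nLie})$ is a graded Lie algebra, and $\bigoplus_{k\ge0}C^{k(n-1)|0}(W,W)$ is a graded Lie subalgebra of it, hence itself a graded Lie algebra. Its Maurer–Cartan elements (the elements $\alpha$ of degree $1$ with $[\alpha,\alpha]_{\rm nLie}=0$) are precisely the $n$-Lie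 algebra structures on $\mathfrak g$ together with a representation on $V$. Precisely: for linear maps $\mu:\wedge^n\mathfrak g\to\mathfrak g$ and $\rho:\wedge^{n-1}\mathfrak g\to\mathfrak{gl}(V)$ let $\mu+\rho\in C^{n-1|0}(W,W)$ be the map $$(x_1+u_1,\dots,x_n+u_n)\mapsto\mu(x_1,\dots,x_n)+\sum_{i=1}^n(-1)^{n-i}\rho(x_1,\dots,\widehat{x_i},\dots,x_n)u_i.$$ Then $\mu+\rho$ is a Maurer–Cartan element if and only if $\mu$ is an $n$-Lie bracket, i.e. $\mu(x_1,\dots,x_{n-1},\mu(y_1,\dots,y_n))=\sum_{i=1}^n\mu(y_1,\dots,\mu(x_1,\dots,x_{n-1},y_i),\dots,y_n)$, and $\rho$ is a representation of $(\mathfrak g,\mu)$ on $V$, i.e. $$[\rho(x_1,\dots,x_{n-1}),\rho(y_1,\dots,y_{n-1})]=\sum_{i=1}^{n-1}\rho(y_1,\dots,\mu(x_1,\dots,x_{n-1},y_i),\dots,y_{n-1}),$$ $$\rho(x_1,\dots,x_{n-2},\mu(y_1,\dots,y_n))=\sum_{i=1}^n(-1)^{n-i}\rho(y_1,\dots,\widehat{y_i},\dots,y_n)\,\rho(x_1,\dots,x_{n-2},y_i);$$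 and every Maurer–Cartan element is of the form $\mu+\rho$ for exactly one such pair $(\mu,\rho)$. -/

import Mathlib

open scoped DirectSum

namespace NLie

section Cochains

/-- Multilinear functions of `m` blocks of `N` vectors and one further vector: linearity in each
of the `m * N + 1` vector arguments separately. -/
structure IsBlockMultilinear (K : Type*) {W : Type*} [Field K] [AddCommGroup W] [Module K W]
    {m N : ℕ} (f : (Fin m → Fin N → W) → W → W) : Prop where
  linear_block : ∀ (X : Fin m → Fin N → W) (x : W) (i : Fin m) (a : Fin N),
    IsLinearMap K fun u => f (Function.update X i (Function.update (X i) a u)) x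
  linear_last : ∀ X : Fin m → Fin N → W, IsLinearMap K (f X)

/-- The cochain condition, for `n = N + 1`: `f` is a multilinear function of
`X 0, …, X (m - 1) ∈ W ^ (n - 1)` and `x ∈ W`, alternating in each block `X i` of `n - 1` vectors,
and alternating in the last `n` vectors (those of the last block `X (m - 1)` together with `x`).
These are the linear maps `⊗^m (∧^(n-1) W) ∧ W → W`, that is
`⊗^(m-1) (∧^(n-1) W) ⊗ ∧^n W → W` for `m ≥ 1` and `W → W` for `m = 0`. -/
structure IsCochain (K : Type*) {W : Type*} [Field K] [AddCommGroup W] [Module K W]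
    {m N : ℕ} (f : (Fin m → Fin N → W) → W → W) : Prop extends IsBlockMultilinear K f where
  alt_block : ∀ (X : Fin m → Fin N → W) (x : W) (i : Fin m) (a b : Fin N),
    a ≠ b → X i a = X i b → f X x = 0
  alt_last : ∀ (X : Fin m → Fin N → W) (x : W) (i : Fin m) (a : Fin N),
    (i : ℕ) + 1 = m → X i a = x → f X x = 0

variable {K W : Type*} [Field K] [AddCommGroup W] [Module K W] {m N p q : ℕ}

theorem isBlockMultilinear_zero :
    IsBlockMultilinear K (0 : (Fin m → Fin N → W) → W → W) :=
  ⟨fun _ _ _ _ => ⟨fun _ _ => by simp, fun _ _ => by simp⟩,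
    fun _ => ⟨fun _ _ => by simp, fun _ _ => by simp⟩⟩

theorem IsBlockMultilinear.add {f g : (Fin m → Fin N → W) → W → W}
    (hf : IsBlockMultilinear K f) (hg : IsBlockMultilinear K g) : IsBlockMultilinear K (f + g) := by
  refine ⟨fun X x i a => ⟨fun u v => ?_, fun c u => ?_⟩, fun X => ⟨fun u v => ?_, fun c u => ?_⟩⟩
  · have h1 := (hf.linear_block X x i a).map_add u v
    have h2 := (hg.linear_block X x i a).map_add u v
    simp only [Pi.add_apply, h1, h2]; abel
  · have h1 := (hf.linear_block X x i a).map_smul c u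
    have h2 := (hg.linear_block X x i a).map_smul c u
    simp only [Pi.add_apply, h1, h2, smul_add]
  · have h1 := (hf.linear_last X).map_add u v
    have h2 := (hg.linear_last X).map_add u v
    simp only [Pi.add_apply, h1, h2]; abel
  · have h1 := (hf.linear_last X).map_smul c u
    have h2 := (hg.linear_last X).map_smul c u
    simp only [Pi.add_apply, h1, h2, smul_add]

theorem IsBlockMultilinear.smul {f : (Fin m → Fin N → W) → W → W}
    (hf : IsBlockMultilinear K f) {S : Type*} [Monoid S] [DistribMulAction S W] [SMulCommClass K S W]
    (c : S) : IsBlockMultilinear K (c • f) := by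
  refine ⟨fun X x i a => ⟨fun u v => ?_, fun d u => ?_⟩, fun X => ⟨fun u v => ?_, fun d u => ?_⟩⟩
  · have h1 := (hf.linear_block X x i a).map_add u v
    simp only [Pi.smul_apply, h1, smul_add]
  · have h1 := (hf.linear_block X x i a).map_smul d u
    simp only [Pi.smul_apply, h1, smul_comm]
  · have h1 := (hf.linear_last X).map_add u v
    simp only [Pi.smul_apply, h1, smul_add]
  · have h1 := (hf.linear_last X).map_smul d u
    simp only [Pi.smul_apply, h1, smul_comm]

theorem IsBlockMultilinear.sum {ι : Type*} (s : Finset ι) {f : ι → (Fin m → Fin N → W) → W → W}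
    (hf : ∀ i ∈ s, IsBlockMultilinear K (f i)) : IsBlockMultilinear K (∑ i ∈ s, f i) := by
  classical
  induction s using Finset.induction_on with
  | empty => simpa using isBlockMultilinear_zero
  | insert a s ha ih =>
    rw [Finset.sum_insert ha]
    exact (hf a (by simp)).add (ih fun i hi => hf i (by simp [hi]))

variable (K W N) in
/-- The space `C^m(W, W) = Hom(⊗^m (∧^(n-1) W) ∧ W, W)` of cochains of degree `m`, for
`n = N + 1`, as a space of functions. -/
def cochainSubmodule (m : ℕ) : Submodule K ((Fin m → Fin N → W) → W → W) where
  carrier := {f | IsCochain K f}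
  zero_mem' := ⟨isBlockMultilinear_zero, fun _ _ _ _ _ _ _ => rfl, fun _ _ _ _ _ _ => rfl⟩
  add_mem' {f g} hf hg := ⟨hf.toIsBlockMultilinear.add hg.toIsBlockMultilinear,
    fun X x i a b hab h => by
      simp [hf.alt_block X x i a b hab h, hg.alt_block X x i a b hab h],
    fun X x i a hi h => by simp [hf.alt_last X x i a hi h, hg.alt_last X x i a hi h]⟩
  smul_mem' c f hf := ⟨hf.toIsBlockMultilinear.smul c,
    fun X x i a b hab h => by simp [hf.alt_block X x i a b hab h],
    fun X x i a hi h => by simp [hf.alt_last X x i a hi h]⟩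

variable (K W N) in
/-- The space `C^m(W, W)` of cochains of degree `m`, for `n = N + 1`, as a type. -/
def Cochain (m : ℕ) : Type _ := ↥(cochainSubmodule K W N m)

noncomputable instance (m : ℕ) : AddCommGroup (Cochain K W N m) :=
  inferInstanceAs (AddCommGroup ↥(cochainSubmodule K W N m))

noncomputable instance (m : ℕ) : Module K (Cochain K W N m) :=
  inferInstanceAs (Module K ↥(cochainSubmodule K W N m))

end Cochains

section Circle

/-- The `(j, q)`-shuffles: permutations of `{0, …, j + q - 1}`, increasing on `{0, …, j - 1}` and
on `{j, …, j + q - 1}`, extended to `{0, …, M - 1}` by the identity. -/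
def shuffles (M j q : ℕ) : Finset (Equiv.Perm (Fin M)) :=
  Finset.univ.filter fun σ =>
    (∀ a b : Fin M, a < b → (b : ℕ) < j → σ a < σ b) ∧
    (∀ a b : Fin M, j ≤ (a : ℕ) → a < b → (b : ℕ) < j + q → σ a < σ b) ∧
    (∀ a : Fin M, j + q ≤ (a : ℕ) → σ a = a)

theorem update_comp_of_eq {A : Type*} {p M : ℕ} {e : Fin p → Fin M} (he : Function.Injective e)
    (X : Fin M → A) (t : Fin p) (B : A) :
    (fun a => Function.update X (e t) B (e a)) = Function.update (fun a => X (e a)) t B := by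
  funext a
  by_cases h : a = t
  · subst h; simp
  · simp [h, he.ne h]

theorem update_comp_of_ne {A : Type*} {p M : ℕ} {e : Fin p → Fin M}
    (X : Fin M → A) {j : Fin M} (h : ∀ t, e t ≠ j) (B : A) :
    (fun a => Function.update X j B (e a)) = (fun a => X (e a)) := by
  funext a
  simp [h a]

variable {K W : Type*} [Field K] [AddCommGroup W] [Module K W] {N p q : ℕ}

/-- The product `P ∘ Q`, evaluated on the blocks `X 0, …, X (p + q - 1)` and the vector `x`.
Everything is indexed from `0`. In the first sum the arguments of `P` are the blocks
`X (σ 0), …, X (σ (k - 1))`, then the block `X (k + q)` with its `i`-th vector `y` replaced by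
`Q (X (σ k), …, X (σ (k + q - 1)), y)`, then the blocks `X (k + q + 1), …, X (p + q - 1)`,
and finally `x`. -/
def circ (P : (Fin p → Fin N → W) → W → W) (Q : (Fin q → Fin N → W) → W → W) :
    (Fin (p + q) → Fin N → W) → W → W := fun X x =>
  (∑ k : Fin p, ∑ σ ∈ shuffles (p + q) k q,
    ((-1) ^ ((k : ℕ) * q) * (Equiv.Perm.sign σ : ℤ)) • ∑ i : Fin N,
      P (Function.update (fun a : Fin p => X (if a < k then σ (Fin.castAdd q a) else a.addNat q)) k
          (Function.update (X (k.addNat q)) i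
            (Q (fun b : Fin q => X (σ ⟨(k : ℕ) + b, by omega⟩)) (X (k.addNat q) i)))) x) +
  ∑ σ ∈ shuffles (p + q) p q,
    ((-1) ^ (p * q) * (Equiv.Perm.sign σ : ℤ)) •
      P (fun a : Fin p => X (σ (Fin.castAdd q a))) (Q (fun b : Fin q => X (σ (Fin.natAdd p b))) x)

/-- One summand of the first part of `circ`. -/
def innerTerm (P : (Fin p → Fin N → W) → W → W) (Q : (Fin q → Fin N → W) → W → W)
    {M : ℕ} (e : Fin p → Fin M) (d : Fin q → Fin M) (k : Fin p) (i : Fin N) :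
    (Fin M → Fin N → W) → W → W := fun X x =>
  P (Function.update (fun a => X (e a)) k
    (Function.update (X (e k)) i (Q (fun b => X (d b)) (X (e k) i)))) x

/-- One summand of the second part of `circ`. -/
def outerTerm (P : (Fin p → Fin N → W) → W → W) (Q : (Fin q → Fin N → W) → W → W)
    {M : ℕ} (e : Fin p → Fin M) (d : Fin q → Fin M) :
    (Fin M → Fin N → W) → W → W := fun X x =>
  P (fun a => X (e a)) (Q (fun b => X (d b)) x)

theorem isLinearMap_comp {f g : W → W} (hf : IsLinearMap K f) (hg : IsLinearMap K g) :
    IsLinearMap K fun u => f (g u) :=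
  ⟨fun u v => by rw [hg.map_add, hf.map_add], fun c u => by rw [hg.map_smul, hf.map_smul]⟩

theorem innerTerm_multilinear {P : (Fin p → Fin N → W) → W → W} {Q : (Fin q → Fin N → W) → W → W}
    (hP : IsBlockMultilinear K P) (hQ : IsBlockMultilinear K Q)
    {M : ℕ} {e : Fin p → Fin M} {d : Fin q → Fin M} (he : Function.Injective e)
    (hd : Function.Injective d) (hed : ∀ a b, e a ≠ d b)
    (hcov : ∀ j, (∃ a, e a = j) ∨ ∃ b, d b = j) (k : Fin p) (i : Fin N) :
    IsBlockMultilinear K (innerTerm P Q e d k i) := by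
  refine ⟨fun X x j c => ?_, fun X => hP.linear_last _⟩
  rcases hcov j with ⟨t, rfl⟩ | ⟨t, rfl⟩
  · have h1 : ∀ B : Fin N → W, (fun b => Function.update X (e t) B (d b)) = fun b => X (d b) :=
      fun B => update_comp_of_ne X (fun b => (hed t b).symm) B
    by_cases htk : t = k
    · subst htk
      unfold innerTerm
      simp only [h1, update_comp_of_eq he, Function.update_idem, Function.update_self]
      by_cases hci : c = i
      · subst hci
        simp only [Function.update_idem, Function.update_self]
        have := hP.linear_block (fun a => X (e a)) x t c
        exact isLinearMap_comp this (hQ.linear_last _)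
      · have h2 : ∀ u, Function.update (Function.update (X (e t)) c u) i
            (Q (fun b => X (d b)) (Function.update (X (e t)) c u i)) =
            Function.update (Function.update (X (e t)) i (Q (fun b => X (d b)) (X (e t) i))) c u := by
          intro u
          rw [Function.update_of_ne (Ne.symm hci), Function.update_comm hci]
        simp only [h2]
        have := hP.linear_block (Function.update (fun a => X (e a)) t
          (Function.update (X (e t)) i (Q (fun b => X (d b)) (X (e t) i)))) x t c
        simpa only [Function.update_idem, Function.update_self] using this
    · unfold innerTerm
      have h3 : ∀ B : Fin N → W, Function.update X (e t) B (e k) = X (e k) := fun B =>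
        Function.update_of_ne (he.ne (Ne.symm htk)) _ _
      simp only [h1, h3, update_comp_of_eq he]
      have := hP.linear_block (Function.update (fun a => X (e a)) k
          (Function.update (X (e k)) i (Q (fun b => X (d b)) (X (e k) i)))) x t c
      simpa only [Function.update_comm (Ne.symm htk), Function.update_of_ne htk] using this
  · unfold innerTerm
    have h1 : ∀ B : Fin N → W, (fun a => Function.update X (d t) B (e a)) = fun a => X (e a) :=
      fun B => update_comp_of_ne X (fun a => hed a t) B
    have h3 : ∀ B : Fin N → W, Function.update X (d t) B (e k) = X (e k) := fun B =>
        Function.update_of_ne (hed k t) _ _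
    simp only [h1, h3, update_comp_of_eq hd]
    have h4 := hP.linear_block (fun a => X (e a)) x k i
    exact isLinearMap_comp h4 (hQ.linear_block (fun b => X (d b)) (X (e k) i) t c)

theorem outerTerm_multilinear {P : (Fin p → Fin N → W) → W → W} {Q : (Fin q → Fin N → W) → W → W}
    (hP : IsBlockMultilinear K P) (hQ : IsBlockMultilinear K Q)
    {M : ℕ} {e : Fin p → Fin M} {d : Fin q → Fin M} (he : Function.Injective e)
    (hd : Function.Injective d) (hed : ∀ a b, e a ≠ d b)
    (hcov : ∀ j, (∃ a, e a = j) ∨ ∃ b, d b = j) :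
    IsBlockMultilinear K (outerTerm P Q e d) := by
  refine ⟨fun X x j c => ?_, fun X =>
    isLinearMap_comp (f := P fun a => X (e a)) (hP.linear_last _) (hQ.linear_last _)⟩
  rcases hcov j with ⟨t, rfl⟩ | ⟨t, rfl⟩
  · have h1 : ∀ B : Fin N → W, (fun b => Function.update X (e t) B (d b)) = fun b => X (d b) :=
      fun B => update_comp_of_ne X (fun b => (hed t b).symm) B
    unfold outerTerm
    simp only [h1, update_comp_of_eq he]
    exact hP.linear_block (fun a => X (e a)) _ t c
  · have h1 : ∀ B : Fin N → W, (fun a => Function.update X (d t) B (e a)) = fun a => X (e a) :=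
      fun B => update_comp_of_ne X (fun a => hed a t) B
    unfold outerTerm
    simp only [h1, update_comp_of_eq hd]
    exact isLinearMap_comp (hP.linear_last _) (hQ.linear_block (fun b => X (d b)) x t c)

/-- Exchanging two vectors of one block changes the sign. -/
theorem IsCochain.swap_block {P : (Fin p → Fin N → W) → W → W} (hP : IsCochain K P)
    (Y : Fin p → Fin N → W) (x : W) (k : Fin p) {a b : Fin N} (hab : a ≠ b) (B : Fin N → W)
    (u v : W) :
    P (Function.update Y k (Function.update (Function.update B a u) b v)) x +
      P (Function.update Y k (Function.update (Function.update B a v) b u)) x = 0 := by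
  have la : ∀ s t t' : W,
      P (Function.update Y k (Function.update (Function.update B a (t + t')) b s)) x =
      P (Function.update Y k (Function.update (Function.update B a t) b s)) x +
      P (Function.update Y k (Function.update (Function.update B a t') b s)) x := by
    intro s t t'
    have := (hP.linear_block (Function.update Y k (Function.update B b s)) x k a).map_add t t'
    simpa only [Function.update_idem, Function.update_self, Function.update_comm hab] using this
  have lb : ∀ s t t' : W,
      P (Function.update Y k (Function.update (Function.update B a s) b (t + t'))) x =
      P (Function.update Y k (Function.update (Function.update B a s) b t)) x +
      P (Function.update Y k (Function.update (Function.update B a s) b t')) x := by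
    intro s t t'
    have := (hP.linear_block (Function.update Y k (Function.update B a s)) x k b).map_add t t'
    simpa only [Function.update_idem, Function.update_self] using this
  have z : ∀ t : W, P (Function.update Y k (Function.update (Function.update B a t) b t)) x = 0 := by
    intro t
    refine hP.alt_block _ x k a b hab ?_
    simp [hab]
  have h := z (u + v)
  rw [la, lb, lb, z, z] at h
  simpa using h

/-- Exchanging a vector of the last block with the last vector changes the sign. -/
theorem IsCochain.swap_last {P : (Fin p → Fin N → W) → W → W} (hP : IsCochain K P)
    (Y : Fin p → Fin N → W) (k : Fin p) (hk : (k : ℕ) + 1 = p) (a : Fin N) (u v : W) :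
    P (Function.update Y k (Function.update (Y k) a u)) v +
      P (Function.update Y k (Function.update (Y k) a v)) u = 0 := by
  have z : ∀ t : W, P (Function.update Y k (Function.update (Y k) a t)) t = 0 := by
    intro t
    exact hP.alt_last _ t k a hk (by simp)
  have h := z (u + v)
  rw [(hP.linear_last _).map_add] at h
  have la : ∀ s, P (Function.update Y k (Function.update (Y k) a (u + v))) s =
      P (Function.update Y k (Function.update (Y k) a u)) s +
      P (Function.update Y k (Function.update (Y k) a v)) s :=
    fun s => (hP.linear_block Y s k a).map_add u v
  rw [la, la, z, z] at h
  rw [zero_add, add_zero, add_comm] at h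
  exact h

theorem IsBlockMultilinear.update_zero {P : (Fin p → Fin N → W) → W → W}
    (hP : IsBlockMultilinear K P) (Y : Fin p → Fin N → W) (x : W) (k : Fin p) (B : Fin N → W)
    (a : Fin N) : P (Function.update Y k (Function.update B a 0)) x = 0 := by
  have := (hP.linear_block (Function.update Y k B) x k a).map_zero
  simpa only [Function.update_idem, Function.update_self] using this

theorem innerTerm_alt {P : (Fin p → Fin N → W) → W → W} {Q : (Fin q → Fin N → W) → W → W}
    (hP : IsCochain K P) (hQ : IsCochain K Q)
    {M : ℕ} {e : Fin p → Fin M} {d : Fin q → Fin M}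
    (hcov : ∀ j, (∃ a, e a = j) ∨ ∃ b, d b = j) (k : Fin p)
    (X : Fin M → Fin N → W) (x : W) (j : Fin M) (a b : Fin N) (hab : a ≠ b) (h : X j a = X j b) :
    ∑ i : Fin N, innerTerm P Q e d k i X x = 0 := by
  rcases hcov j with ⟨t, rfl⟩ | ⟨t, rfl⟩
  · by_cases htk : t = k
    · subst htk
      rw [Fintype.sum_eq_add a b hab]
      · unfold innerTerm
        rw [← h]
        have := hP.swap_block (fun a => X (e a)) x t hab (X (e t))
          (Q (fun b => X (d b)) (X (e t) a)) (X (e t) a)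
        have e1 : ∀ y, Function.update (Function.update (X (e t)) a y) b (X (e t) a) =
            Function.update (X (e t)) a y := by
          intro y
          rw [Function.update_comm hab, h, Function.update_eq_self]
        have e2 : ∀ y, Function.update (Function.update (X (e t)) a (X (e t) a)) b y =
            Function.update (X (e t)) b y := by
          intro y
          rw [Function.update_eq_self]
        rw [e1, e2] at this
        exact this
      · rintro i ⟨hia, hib⟩
        refine hP.alt_block _ x t a b hab ?_
        simp [Ne.symm hia, Ne.symm hib, h]
    · refine Finset.sum_eq_zero fun i _ => hP.alt_block _ x t a b hab ?_
      simp [htk, h]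
  · refine Finset.sum_eq_zero fun i _ => ?_
    unfold innerTerm
    rw [hQ.alt_block (fun b => X (d b)) _ t a b hab h]
    exact hP.toIsBlockMultilinear.update_zero _ _ _ _ _

theorem outerTerm_alt {P : (Fin p → Fin N → W) → W → W} {Q : (Fin q → Fin N → W) → W → W}
    (hP : IsCochain K P) (hQ : IsCochain K Q)
    {M : ℕ} {e : Fin p → Fin M} {d : Fin q → Fin M}
    (hcov : ∀ j, (∃ a, e a = j) ∨ ∃ b, d b = j)
    (X : Fin M → Fin N → W) (x : W) (j : Fin M) (a b : Fin N) (hab : a ≠ b) (h : X j a = X j b) :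
    outerTerm P Q e d X x = 0 := by
  rcases hcov j with ⟨t, rfl⟩ | ⟨t, rfl⟩
  · exact hP.alt_block _ _ t a b hab h
  · unfold outerTerm
    rw [hQ.alt_block (fun b => X (d b)) x t a b hab h]
    exact (hP.linear_last _).map_zero

theorem shuffle_injective_front {k : ℕ} {σ : Equiv.Perm (Fin (p + q))}
    (hσ : ∀ a : Fin (p + q), k + q ≤ (a : ℕ) → σ a = a) :
    Function.Injective fun a : Fin p =>
      if (a : ℕ) < k then σ (Fin.castAdd q a) else a.addNat q := by
  have h0 : ∀ a : Fin p, ¬ (a : ℕ) < k → σ (a.addNat q) = a.addNat q := fun a ha =>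
    hσ _ (by simp; omega)
  intro a b h
  simp only at h
  split_ifs at h with h1 h2 h2
  · simpa using h
  · rw [← h0 b h2] at h
    have := congrArg Fin.val (σ.injective h)
    simp at this; omega
  · rw [← h0 a h1] at h
    have := congrArg Fin.val (σ.injective h)
    simp at this; omega
  · simpa using h

theorem shuffle_disjoint {k : ℕ} (hk : k ≤ p) {σ : Equiv.Perm (Fin (p + q))}
    (hσ : ∀ a : Fin (p + q), k + q ≤ (a : ℕ) → σ a = a) (a : Fin p) (b : Fin q) :
    (if (a : ℕ) < k then σ (Fin.castAdd q a) else a.addNat q) ≠ σ ⟨k + b, by omega⟩ := by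
  intro h
  split_ifs at h with h1
  · have := congrArg Fin.val (σ.injective h)
    simp at this; omega
  · rw [← hσ (a.addNat q) (by simp; omega)] at h
    have := congrArg Fin.val (σ.injective h)
    simp at this; omega

theorem shuffle_cover {k : ℕ} (hk : k ≤ p) {σ : Equiv.Perm (Fin (p + q))}
    (hσ : ∀ a : Fin (p + q), k + q ≤ (a : ℕ) → σ a = a) (j : Fin (p + q)) :
    (∃ a : Fin p, (if (a : ℕ) < k then σ (Fin.castAdd q a) else a.addNat q) = j) ∨
      ∃ b : Fin q, σ ⟨k + b, by omega⟩ = j := by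
  obtain ⟨s, rfl⟩ := σ.surjective j
  by_cases h1 : (s : ℕ) < k
  · left
    refine ⟨⟨s, by omega⟩, ?_⟩
    simp [h1]
  · by_cases h2 : (s : ℕ) < k + q
    · right
      refine ⟨⟨s - k, by omega⟩, ?_⟩
      congr 1; ext; simp; omega
    · left
      have := s.isLt
      refine ⟨⟨s - q, by omega⟩, ?_⟩
      rw [if_neg (by simp; omega), hσ s (by omega)]
      ext; simp; omega

theorem circ_eq (P : (Fin p → Fin N → W) → W → W) (Q : (Fin q → Fin N → W) → W → W) :
    circ P Q =
    (∑ k : Fin p, ∑ σ ∈ shuffles (p + q) k q,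
      ((-1) ^ ((k : ℕ) * q) * (Equiv.Perm.sign σ : ℤ)) • ∑ i : Fin N,
        innerTerm P Q
          (fun a : Fin p => if (a : ℕ) < k then σ (Fin.castAdd q a) else a.addNat q)
          (fun b : Fin q => σ ⟨(k : ℕ) + b, by omega⟩) k i) +
    ∑ σ ∈ shuffles (p + q) p q, ((-1) ^ (p * q) * (Equiv.Perm.sign σ : ℤ)) •
      outerTerm P Q (fun a : Fin p => if (a : ℕ) < p then σ (Fin.castAdd q a) else a.addNat q)
        (fun b : Fin q => σ ⟨p + b, by omega⟩) := by
  funext X x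
  simp only [circ, innerTerm, outerTerm, Pi.add_apply, Finset.sum_apply, Pi.smul_apply,
    Fin.is_lt, if_true, lt_irrefl, if_false, Fin.lt_def]
  rfl

theorem mem_shuffles_fix {M j : ℕ} {σ : Equiv.Perm (Fin M)} (h : σ ∈ shuffles M j q) :
    ∀ a : Fin M, j + q ≤ (a : ℕ) → σ a = a := by
  simp only [shuffles, Finset.mem_filter] at h
  exact h.2.2.2

theorem circ_multilinear {P : (Fin p → Fin N → W) → W → W} {Q : (Fin q → Fin N → W) → W → W}
    (hP : IsBlockMultilinear K P) (hQ : IsBlockMultilinear K Q) :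
    IsBlockMultilinear K (circ P Q) := by
  rw [circ_eq]
  refine (IsBlockMultilinear.sum _ fun k _ => IsBlockMultilinear.sum _ fun σ hσ =>
    (IsBlockMultilinear.sum _ fun i _ => ?_).smul _).add
    (IsBlockMultilinear.sum _ fun σ hσ => IsBlockMultilinear.smul ?_ _)
  · have h := mem_shuffles_fix hσ
    exact innerTerm_multilinear hP hQ (shuffle_injective_front h)
      (fun a b hab => by simpa [Fin.ext_iff] using σ.injective hab)
      (shuffle_disjoint k.isLt.le h) (shuffle_cover k.isLt.le h) k i
  · have h := mem_shuffles_fix hσ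
    exact outerTerm_multilinear hP hQ (shuffle_injective_front h)
      (fun a b hab => by simpa [Fin.ext_iff] using σ.injective hab)
      (shuffle_disjoint le_rfl h) (shuffle_cover le_rfl h)

theorem circ_alt_block {P : (Fin p → Fin N → W) → W → W} {Q : (Fin q → Fin N → W) → W → W}
    (hP : IsCochain K P) (hQ : IsCochain K Q) (X : Fin (p + q) → Fin N → W) (x : W)
    (j : Fin (p + q)) (a b : Fin N) (hab : a ≠ b) (h : X j a = X j b) : circ P Q X x = 0 := by
  rw [circ_eq]
  simp only [Pi.add_apply, Finset.sum_apply, Pi.smul_apply]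
  rw [Finset.sum_eq_zero, Finset.sum_eq_zero, add_zero]
  · intro σ hσ
    rw [outerTerm_alt hP hQ (shuffle_cover le_rfl (mem_shuffles_fix hσ)) X x j a b hab h, smul_zero]
  · intro k _
    refine Finset.sum_eq_zero fun σ hσ => ?_
    rw [innerTerm_alt hP hQ (shuffle_cover k.isLt.le (mem_shuffles_fix hσ)) k X x j a b hab h,
      smul_zero]

theorem cycle_facts {r q : ℕ} : ∃ C : Equiv.Perm (Fin (r + 1 + q)),
    (∀ a : Fin (r + 1 + q), (a : ℕ) < r → C a = a) ∧
    (∀ (a b : Fin (r + 1 + q)), r ≤ (a : ℕ) → (a : ℕ) < r + q → (b : ℕ) = a + 1 → C a = b) ∧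
    (∀ (a b : Fin (r + 1 + q)), (a : ℕ) = r + q → (b : ℕ) = r → C a = b) ∧
    Equiv.Perm.sign C = (-1) ^ q := by
  have : NeZero (r + 1 + q) := ⟨by omega⟩
  refine ⟨Fin.cycleIcc ⟨r, by omega⟩ ⟨r + q, by omega⟩, ?_, ?_, ?_, ?_⟩
  · intro a ha
    exact Fin.cycleIcc_of_lt (by rw [Fin.lt_def]; exact ha)
  · intro a b h1 h2 h3
    rw [Fin.cycleIcc_of_ge_of_lt (by rw [Fin.le_def]; exact h1) (by rw [Fin.lt_def]; exact h2)]
    ext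
    rw [h3, Fin.val_add_one_of_lt' (by omega)]
  · intro a b h1 h2
    have h3 : a = ⟨r + q, by omega⟩ := Fin.ext h1
    rw [h3, Fin.cycleIcc_of_last (by rw [Fin.le_def]; simp)]
    exact Fin.ext h2.symm
  · rw [Fin.sign_cycleIcc_of_le (by rw [Fin.le_def]; simp)]
    simp

/-- The terms of `circ` in which `Q` acts on a vector of the last block, or on the last vector,
cancel if a vector of the last block equals the last vector. -/
theorem circ_alt_last_aux {r q : ℕ} {P : (Fin (r + 1) → Fin N → W) → W → W}
    {Q : (Fin q → Fin N → W) → W → W}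
    (hP : IsCochain K P) (hQ : IsCochain K Q) (X : Fin (r + 1 + q) → Fin N → W) (x : W)
    (L : Fin (r + 1 + q)) (hL : (L : ℕ) = r + q) (a : Fin N) (h : X L a = x) :
    circ P Q X x = 0 := by
  have hLq : (Fin.last r).addNat q = L := by ext; simp [hL]
  set r0 : Fin (r + 1 + q) := ⟨r, by omega⟩ with hr0
  have hr0' : Fin.castAdd q (Fin.last r) = r0 := by ext; simp [hr0]
  have key : ∀ Y : Fin (r + 1) → Fin N → W, Y (Fin.last r) = X L → ∀ y,
      P (Function.update Y (Fin.last r) (Function.update (X L) a y)) x = - P Y y := by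
    intro Y hY y
    have := hP.swap_last Y (Fin.last r) (by simp) a y x
    rw [hY, ← h, Function.update_eq_self, ← hY, Function.update_eq_self, hY] at this
    rw [← h]
    exact eq_neg_of_add_eq_zero_left this
  simp only [circ]
  rw [Fin.sum_univ_castSucc, Finset.sum_eq_zero, zero_add]
  swap
  · intro k _
    refine Finset.sum_eq_zero fun σ _ => ?_
    rw [Finset.sum_eq_zero, smul_zero]
    intro i _
    refine hP.alt_last _ _ (Fin.last r) a (by simp) ?_
    rw [Function.update_of_ne (Fin.castSucc_lt_last k).ne']
    rw [if_neg (not_lt.mpr (Fin.castSucc_lt_last k).le), hLq, h]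
  have h1 : ∀ σ ∈ shuffles (r + 1 + q) ((Fin.last r : Fin (r + 1)) : ℕ) q,
      ((-1) ^ (((Fin.last r : Fin (r + 1)) : ℕ) * q) * (Equiv.Perm.sign σ : ℤ)) • ∑ i : Fin N,
      P (Function.update (fun a : Fin (r + 1) =>
          X (if a < Fin.last r then σ (Fin.castAdd q a) else a.addNat q)) (Fin.last r)
          (Function.update (X ((Fin.last r).addNat q)) i
            (Q (fun b : Fin q => X (σ ⟨((Fin.last r : Fin (r + 1)) : ℕ) + b, by simp; omega⟩))
              (X ((Fin.last r).addNat q) i)))) x =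
      - (((-1) ^ (r * q) * (Equiv.Perm.sign σ : ℤ)) •
        P (fun a : Fin (r + 1) => X (if a < Fin.last r then σ (Fin.castAdd q a) else a.addNat q))
          (Q (fun b : Fin q => X (σ ⟨r + b, by omega⟩)) x)) := by
    intro σ hσ
    rw [Finset.sum_eq_single a, hLq, key _ (by simp [hLq]), h, smul_neg]
    · rfl
    · intro i _ hia
      refine hP.alt_last _ _ (Fin.last r) a (by simp) ?_
      rw [Function.update_self, Function.update_of_ne (Ne.symm hia), hLq, h]
    · simp
  rw [Finset.sum_congr rfl h1, Finset.sum_neg_distrib, neg_add_eq_zero]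
  have h2 : ∀ σ ∈ shuffles (r + 1 + q) (r + 1) q,
      ((-1) ^ ((r + 1) * q) * (Equiv.Perm.sign σ : ℤ)) •
        P (fun a => X (σ (Fin.castAdd q a))) (Q (fun b => X (σ (Fin.natAdd (r + 1) b))) x) ≠ 0 →
      σ r0 = L := by
    intro σ hσ hne
    by_contra hc
    apply hne
    obtain ⟨s, hs⟩ := σ.surjective L
    simp only [shuffles, Finset.mem_filter, Finset.mem_univ, true_and] at hσ
    have hmax : ∀ t, ¬ L < t := fun t ht => by
      have := t.isLt
      rw [Fin.lt_def] at ht; omega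
    have hsr : s ≠ r0 := fun e => hc (e ▸ hs)
    have hsr' : (s : ℕ) ≠ r := fun e => hsr (Fin.ext e)
    by_cases hsl : (s : ℕ) < r
    · exact absurd (hs ▸ hσ.1 s r0 (by rw [Fin.lt_def]; exact hsl) (by simp [hr0])) (hmax _)
    · by_cases hsL : s = L
      · subst hsL
        have hq : r + 1 ≤ (s : ℕ) := by omega
        rw [hQ.alt_last (fun b => X (σ (Fin.natAdd (r + 1) b))) x ⟨s - (r + 1), by omega⟩ a
          (by simp; omega), (hP.linear_last _).map_zero, smul_zero]
        have : Fin.natAdd (r + 1) (⟨s - (r + 1), by omega⟩ : Fin q) = s := by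
          ext; simp; omega
        rw [this, hs, h]
      · have : (s : ℕ) ≠ r + q := fun e => hsL (Fin.ext (e.trans hL.symm))
        have := s.isLt
        exact absurd (hs ▸ hσ.2.1 s L (by omega) (by rw [Fin.lt_def]; omega) (by omega)) (hmax _)
  obtain ⟨C, hC1, hC2, hC3, hCs⟩ := cycle_facts (r := r) (q := q)
  rw [← Finset.sum_filter_of_ne h2]
  symm
  refine Finset.sum_nbij' (fun σ => σ * C) (fun τ => τ * C⁻¹) ?_ ?_ ?_ ?_ ?_
  · intro σ hσ
    simp only [shuffles, Finset.mem_filter, Finset.mem_univ, true_and] at hσ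
    obtain ⟨⟨hσ1, hσ2, -⟩, hσ4⟩ := hσ
    simp only [shuffles, Finset.mem_filter, Finset.mem_univ, true_and, Fin.val_last,
      Equiv.Perm.mul_apply]
    refine ⟨fun a b hab hb => ?_, fun a b ha hab hb => ?_, fun a ha => ?_⟩
    · rw [hC1 b hb, hC1 a (by rw [Fin.lt_def] at hab; omega)]
      exact hσ1 a b hab (by omega)
    · rw [Fin.lt_def] at hab
      rw [hC2 a ⟨a + 1, by omega⟩ ha (by omega) rfl, hC2 b ⟨b + 1, by omega⟩ (by omega) hb rfl]
      exact hσ2 _ _ (by simp; omega) (by rw [Fin.lt_def]; simp; omega) (by simp; omega)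
    · have := a.isLt
      rw [hC3 a r0 (by omega) rfl, hσ4]
      ext; omega
  · intro τ hτ
    simp only [shuffles, Finset.mem_filter, Finset.mem_univ, true_and, Fin.val_last] at hτ
    obtain ⟨hτ1, hτ2, hτ3⟩ := hτ
    have hτL : τ L = L := hτ3 L (by omega)
    have hI1 : ∀ a : Fin (r + 1 + q), (a : ℕ) < r → C⁻¹ a = a := fun a ha => by
      rw [Equiv.Perm.inv_eq_iff_eq, hC1 a ha]
    have hI2 : ∀ (a b : Fin (r + 1 + q)), r + 1 ≤ (a : ℕ) → (a : ℕ) = b + 1 → C⁻¹ a = b :=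
      fun a b ha hb => by
        have := a.isLt
        rw [Equiv.Perm.inv_eq_iff_eq, hC2 b a (by omega) (by omega) hb]
    have hI3 : C⁻¹ r0 = L := by rw [Equiv.Perm.inv_eq_iff_eq, hC3 L r0 hL rfl]
    simp only [shuffles, Finset.mem_filter, Finset.mem_univ, true_and, Equiv.Perm.mul_apply]
    refine ⟨⟨fun a b hab hb => ?_, fun a b ha hab hb => ?_, fun a ha => ?_⟩, ?_⟩
    · rw [Fin.lt_def] at hab
      rw [hI1 a (by omega)]
      by_cases hbr : (b : ℕ) < r
      · rw [hI1 b hbr]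
        exact hτ1 a b hab hbr
      · have : b = r0 := Fin.ext (by simp [hr0]; omega)
        rw [this, hI3, hτL]
        have hne : τ a ≠ L := fun e => by
          have := τ.injective (e.trans hτL.symm)
          have := congrArg Fin.val this
          omega
        have := (τ a).isLt
        have : (τ a : ℕ) ≠ L := fun e => hne (Fin.ext e)
        rw [Fin.lt_def]; omega
    · rw [Fin.lt_def] at hab
      rw [hI2 a ⟨a - 1, by omega⟩ ha (by simp; omega), hI2 b ⟨b - 1, by omega⟩ (by omega)
        (by simp; omega)]
      exact hτ2 _ _ (by simp; omega) (by rw [Fin.lt_def]; simp; omega) (by simp; omega)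
    · have := a.isLt; omega
    · rw [hI3, hτL]
  · intro σ _; simp
  · intro τ _; simp
  · intro σ hσ
    simp only [shuffles, Finset.mem_filter, Finset.mem_univ, true_and] at hσ
    obtain ⟨⟨hσ1, hσ2, -⟩, hσ4⟩ := hσ
    have e1 : ∀ a : Fin (r + 1), (if a < Fin.last r then (σ * C) (Fin.castAdd q a)
        else a.addNat q) = σ (Fin.castAdd q a) := by
      intro a
      split_ifs with ha
      · rw [Equiv.Perm.mul_apply, hC1 _ (by simpa [Fin.lt_def] using ha)]
      · have : a = Fin.last r := by
          by_contra hne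
          exact ha (Fin.lt_last_iff_ne_last.mpr hne)
        rw [this, hLq, hr0', hσ4]
    have e2 : ∀ b : Fin q, (σ * C) ⟨r + b, by omega⟩ = σ (Fin.natAdd (r + 1) b) := by
      intro b
      rw [Equiv.Perm.mul_apply, hC2 _ (Fin.natAdd (r + 1) b) (by simp) (by simp) (by simp; omega)]
    simp only [e1, e2]
    congr 1
    rw [Equiv.Perm.sign_mul, hCs]
    push_cast
    ring

theorem circ_isCochain {P : (Fin p → Fin N → W) → W → W} {Q : (Fin q → Fin N → W) → W → W}
    (hP : IsCochain K P) (hQ : IsCochain K Q) : IsCochain K (circ P Q) := by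
  refine ⟨circ_multilinear hP.toIsBlockMultilinear hQ.toIsBlockMultilinear,
    circ_alt_block hP hQ, fun X x L a hL h => ?_⟩
  cases p with
  | succ r => exact circ_alt_last_aux hP hQ X x L (by omega) a h
  | zero =>
    simp only [circ, Finset.univ_eq_empty, Finset.sum_empty, zero_add]
    refine Finset.sum_eq_zero fun σ hσ => ?_
    simp only [shuffles, Finset.mem_filter, Finset.mem_univ, true_and] at hσ
    have hσ1 : StrictMono σ := fun a b hab => hσ.2.1 a b (by omega) hab (by omega)
    have hσid : ∀ a, σ a = a := fun a => by
      have := hσ1.range_inj (g := id) strictMono_id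
      rw [this.mp (by simp [σ.surjective.range_eq])]; rfl
    rw [hQ.alt_last (fun b => X (σ (Fin.natAdd 0 b))) x ⟨L, by omega⟩ a (by simp; omega),
      (hP.linear_last _).map_zero, smul_zero]
    rw [hσid, ← h]
    congr 2
    ext; simp

theorem circ_add_left (P P' : (Fin p → Fin N → W) → W → W) (Q : (Fin q → Fin N → W) → W → W) :
    circ (P + P') Q = circ P Q + circ P' Q := by
  funext X x
  simp only [circ, Pi.add_apply, Finset.sum_add_distrib, smul_add]
  abel

theorem circ_smul_left (c : K) (P : (Fin p → Fin N → W) → W → W)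
    (Q : (Fin q → Fin N → W) → W → W) : circ (c • P) Q = c • circ P Q := by
  funext X x
  simp only [circ, Pi.smul_apply, smul_add, Finset.smul_sum]
  simp only [smul_comm c]

theorem circ_add_right {P : (Fin p → Fin N → W) → W → W} (hP : IsBlockMultilinear K P)
    (Q Q' : (Fin q → Fin N → W) → W → W) : circ P (Q + Q') = circ P Q + circ P Q' := by
  rw [circ_eq, circ_eq, circ_eq]
  have h1 : ∀ (e : Fin p → Fin (p + q)) (d : Fin q → Fin (p + q)) (k : Fin p) (i : Fin N),
      innerTerm P (Q + Q') e d k i = innerTerm P Q e d k i + innerTerm P Q' e d k i := by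
    intro e d k i
    funext X x
    exact (hP.linear_block (fun a => X (e a)) x k i).map_add _ _
  have h2 : ∀ (e : Fin p → Fin (p + q)) (d : Fin q → Fin (p + q)),
      outerTerm P (Q + Q') e d = outerTerm P Q e d + outerTerm P Q' e d := by
    intro e d
    funext X x
    exact (hP.linear_last (fun a => X (e a))).map_add _ _
  simp only [h1, h2, Finset.sum_add_distrib, smul_add]
  abel

theorem circ_smul_right {P : (Fin p → Fin N → W) → W → W} (hP : IsBlockMultilinear K P) (c : K)
    (Q : (Fin q → Fin N → W) → W → W) : circ P (c • Q) = c • circ P Q := by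
  rw [circ_eq, circ_eq]
  have h1 : ∀ (e : Fin p → Fin (p + q)) (d : Fin q → Fin (p + q)) (k : Fin p) (i : Fin N),
      innerTerm P (c • Q) e d k i = c • innerTerm P Q e d k i := by
    intro e d k i
    funext X x
    exact (hP.linear_block (fun a => X (e a)) x k i).map_smul _ _
  have h2 : ∀ (e : Fin p → Fin (p + q)) (d : Fin q → Fin (p + q)),
      outerTerm P (c • Q) e d = c • outerTerm P Q e d := by
    intro e d
    funext X x
    exact (hP.linear_last (fun a => X (e a))).map_smul _ _
  simp only [h1, h2, smul_add, Finset.smul_sum, smul_comm c]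

variable (K W N) in
/-- The bilinear map `(P, Q) ↦ P ∘ Q` from `C^p × C^q` to `C^(p+q)`. -/
noncomputable def circLin (p q : ℕ) : Cochain K W N p →ₗ[K] Cochain K W N q →ₗ[K] Cochain K W N (p + q) :=
  LinearMap.mk₂ K (fun P Q => ⟨circ P.1 Q.1, circ_isCochain P.2 Q.2⟩)
    (fun P P' Q => Subtype.ext (circ_add_left P.1 P'.1 Q.1))
    (fun c P Q => Subtype.ext (circ_smul_left c P.1 Q.1))
    (fun P Q Q' => Subtype.ext (circ_add_right P.2.toIsBlockMultilinear Q.1 Q'.1))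
    (fun c P Q => Subtype.ext (circ_smul_right P.2.toIsBlockMultilinear c Q.1))

variable (K W N) in
/-- The bracket `[P, Q] = P ∘ Q - (-1)^(p q) Q ∘ P` of `P ∈ C^p` and `Q ∈ C^q`, as an element
of `⨁ m, C^m` (concentrated in degree `p + q`). -/
noncomputable def bracketHom (p q : ℕ) :
    Cochain K W N p →ₗ[K] Cochain K W N q →ₗ[K] ⨁ m, Cochain K W N m :=
  (circLin K W N p q).compr₂ (DirectSum.lof K ℕ (fun m => Cochain K W N m) (p + q)) -
    (-1 : K) ^ (p * q) •
      ((circLin K W N q p).compr₂ (DirectSum.lof K ℕ (fun m => Cochain K W N m) (q + p))).flip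

variable (K W N) in
/-- The bracket `[-, -]` on `C^*(W, W) = ⨁ m, C^m(W, W)`. -/
noncomputable def nLieBracket :
    (⨁ m, Cochain K W N m) →ₗ[K] (⨁ m, Cochain K W N m) →ₗ[K] ⨁ m, Cochain K W N m :=
  DirectSum.toModule K ℕ _ fun p =>
    (DirectSum.toModule K ℕ _ fun q => (bracketHom K W N p q).flip).flip

theorem nLieBracket_lof (p q : ℕ) (P : Cochain K W N p) (Q : Cochain K W N q) :
    nLieBracket K W N (DirectSum.lof K ℕ (fun m => Cochain K W N m) p P)
      (DirectSum.lof K ℕ (fun m => Cochain K W N m) q Q) =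
    DirectSum.lof K ℕ (fun m => Cochain K W N m) (p + q) (circLin K W N p q P Q) -
      (-1 : K) ^ (p * q) •
        DirectSum.lof K ℕ (fun m => Cochain K W N m) (q + p) (circLin K W N q p Q P) := by
  simp [nLieBracket, bracketHom]

end Circle

section GradedLie

variable {K : Type*} [Field K] {L : ℕ → Type*} [∀ k, AddCommGroup (L k)] [∀ k, Module K (L k)]

/-- A bilinear bracket on `⨁ k, L k` making it a graded Lie algebra. -/
structure IsGradedLieBracket (br : (⨁ k, L k) →ₗ[K] (⨁ k, L k) →ₗ[K] ⨁ k, L k) : Prop where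
  degree : ∀ (p q : ℕ) (x : L p) (y : L q), ∃ z : L (p + q),
    br (DirectSum.lof K ℕ L p x) (DirectSum.lof K ℕ L q y) = DirectSum.lof K ℕ L (p + q) z
  skew : ∀ (p q : ℕ) (x : L p) (y : L q),
    br (DirectSum.lof K ℕ L p x) (DirectSum.lof K ℕ L q y) =
      -((-1 : K) ^ (p * q) • br (DirectSum.lof K ℕ L q y) (DirectSum.lof K ℕ L p x))
  jacobi : ∀ (p q s : ℕ) (x : L p) (y : L q) (z : L s),
    br (DirectSum.lof K ℕ L p x) (br (DirectSum.lof K ℕ L q y) (DirectSum.lof K ℕ L s z)) =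
      br (br (DirectSum.lof K ℕ L p x) (DirectSum.lof K ℕ L q y)) (DirectSum.lof K ℕ L s z) +
      (-1 : K) ^ (p * q) •
        br (DirectSum.lof K ℕ L q y) (br (DirectSum.lof K ℕ L p x) (DirectSum.lof K ℕ L s z))

/-- Maurer-Cartan elements: elements `α` of degree `1` with `[α, α] = 0`. -/
def IsMaurerCartan (br : (⨁ k, L k) →ₗ[K] (⨁ k, L k) →ₗ[K] ⨁ k, L k) (α : ⨁ k, L k) : Prop :=
  (∃ a : L 1, α = DirectSum.lof K ℕ L 1 a) ∧ br α α = 0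

end GradedLie

section Bidegree

variable {g V : Type*} [AddCommGroup g] [AddCommGroup V] {m N : ℕ}

/-- All the arguments of a cochain as one family: `some (i, a)` is the vector `X i a` and `none`
is the last vector `x`. -/
def args {W : Type*} (X : Fin m → Fin N → W) (x : W) : Option (Fin m × Fin N) → W
  | some ia => X ia.1 ia.2
  | none => x

/-- The arguments in the positions of `S` lie in `g`, the other ones lie in `V`. -/
def HasType (S : Finset (Option (Fin m × Fin N))) (X : Fin m → Fin N → g × V) (x : g × V) : Prop :=
  ∀ o, (o ∈ S → (args X x o).2 = 0) ∧ (o ∉ S → (args X x o).1 = 0)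

/-- `f` has bidegree `k|l`: it maps arguments of which `k + 1` lie in `g` and `l` in `V` to `g`,
arguments of which `k` lie in `g` and `l + 1` in `V` to `V`, and vanishes in all other cases. -/
def HasBidegree (k l : ℤ) (f : (Fin m → Fin N → g × V) → g × V → g × V) : Prop :=
  k + l = m * N ∧
  ∀ (S : Finset (Option (Fin m × Fin N))) (X : Fin m → Fin N → g × V) (x : g × V),
    HasType S X x →
    (((S.card : ℤ) = k + 1 ∧ (Sᶜ.card : ℤ) = l) → (f X x).2 = 0) ∧
    (((S.card : ℤ) = k ∧ (Sᶜ.card : ℤ) = l + 1) → (f X x).1 = 0) ∧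
    (¬ ((S.card : ℤ) = k + 1 ∧ (Sᶜ.card : ℤ) = l) →
      ¬ ((S.card : ℤ) = k ∧ (Sᶜ.card : ℤ) = l + 1) → f X x = 0)

variable (K g V : Type*) [Field K] [AddCommGroup g] [Module K g] [AddCommGroup V] [Module K V]

/-- `C^{m(n-1)|0}(g ⊕ V, g ⊕ V)`, for `n = N + 1`, as a subspace of `C^m(g ⊕ V, g ⊕ V)`. -/
def bidegreeSubmodule (N m : ℕ) : Submodule K (Cochain K (g × V) N m) where
  carrier := {f | HasBidegree (m * N) 0 f.1}
  zero_mem' := ⟨by simp, fun _ _ _ _ => ⟨fun _ => rfl, fun _ => rfl, fun _ _ => rfl⟩⟩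
  add_mem' {f f'} hf hf' := by
    have h0 : ∀ X x, (f + f').1 X x = f.1 X x + f'.1 X x := fun _ _ => rfl
    refine ⟨by simp, fun S X x h => ?_⟩
    rw [h0]
    exact ⟨fun h1 => by simp [(hf.2 S X x h).1 h1, (hf'.2 S X x h).1 h1],
      fun h1 => by simp [(hf.2 S X x h).2.1 h1, (hf'.2 S X x h).2.1 h1],
      fun h1 h2 => by rw [(hf.2 S X x h).2.2 h1 h2, (hf'.2 S X x h).2.2 h1 h2, add_zero]⟩
  smul_mem' c f hf := by
    have h0 : ∀ X x, (c • f).1 X x = c • f.1 X x := fun _ _ => rfl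
    refine ⟨by simp, fun S X x h => ?_⟩
    rw [h0]
    exact ⟨fun h1 => by simp [(hf.2 S X x h).1 h1],
      fun h1 => by simp [(hf.2 S X x h).2.1 h1],
      fun h1 h2 => by rw [(hf.2 S X x h).2.2 h1 h2, smul_zero]⟩

/-- `C^{m(n-1)|0}(g ⊕ V, g ⊕ V)`, for `n = N + 1`, as a type. -/
def BidegreeCochain (N m : ℕ) : Type _ := ↥(bidegreeSubmodule K g V N m)

noncomputable instance (N m : ℕ) : AddCommGroup (BidegreeCochain K g V N m) :=
  inferInstanceAs (AddCommGroup ↥(bidegreeSubmodule K g V N m))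

noncomputable instance (N m : ℕ) : Module K (BidegreeCochain K g V N m) :=
  inferInstanceAs (Module K ↥(bidegreeSubmodule K g V N m))

/-- The inclusion of `⨁ k, C^{k(n-1)|0}(g ⊕ V, g ⊕ V)` into `C^*(g ⊕ V, g ⊕ V)`, `n = N + 1`. -/
noncomputable def bidegreeInclusion (N : ℕ) :
    (⨁ k, BidegreeCochain K g V N k) →ₗ[K] ⨁ k, Cochain K (g × V) N k :=
  DirectSum.lmap fun k => (bidegreeSubmodule K g V N k).subtype

end Bidegree

section Pairs

variable {K g V : Type*} [Field K] [AddCommGroup g] [Module K g] [AddCommGroup V] [Module K V]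

/-- `μ` is an `n`-Lie algebra structure on `g` (`n = N + 1`): the Filippov identity. -/
def IsNLieAlgebra {N : ℕ} (μ : g [⋀^Fin (N + 1)]→ₗ[K] g) : Prop :=
  ∀ (x : Fin N → g) (y : Fin (N + 1) → g),
    μ (Fin.snoc (α := fun _ => g) x (μ y)) =
      ∑ i, μ (Function.update y i (μ (Fin.snoc (α := fun _ => g) x (y i))))

/-- `ρ` is a representation on `V` of the `n`-Lie algebra `(g, μ)`, for `n = r + 2`. The sign in
the second identity is `(-1)^(n-i)` when `i` is counted from `1`. -/
structure IsNLieRepresentation {r : ℕ} (μ : g [⋀^Fin (r + 2)]→ₗ[K] g)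
    (ρ : g [⋀^Fin (r + 1)]→ₗ[K] Module.End K V) : Prop where
  commutator : ∀ x y : Fin (r + 1) → g,
    ρ x * ρ y - ρ y * ρ x =
      ∑ i, ρ (Function.update y i (μ (Fin.snoc (α := fun _ => g) x (y i))))
  bracket : ∀ (x : Fin r → g) (y : Fin (r + 2) → g),
    ρ (Fin.snoc (α := fun _ => g) x (μ y)) =
      ∑ i : Fin (r + 2), (-1 : K) ^ (r + 1 - (i : ℕ)) •
        (ρ (i.removeNth y) * ρ (Fin.snoc (α := fun _ => g) x (y i)))

/-- The lift `μ + ρ` on `g ⊕ V`: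
`(x₁ + u₁, …, xₙ + uₙ) ↦ μ(x₁, …, xₙ) + ∑ i, (-1)^(n-i) ρ(x₁, …, x̂ᵢ, …, xₙ) uᵢ`, for `n = r + 2`
(here `i` is counted from `1`, in the code from `0`). -/
def liftFun {r : ℕ} (μ : g [⋀^Fin (r + 2)]→ₗ[K] g) (ρ : g [⋀^Fin (r + 1)]→ₗ[K] Module.End K V)
    (w : Fin (r + 2) → g × V) : g × V :=
  (μ fun i => (w i).1,
    ∑ i : Fin (r + 2), (-1 : K) ^ (r + 1 - (i : ℕ)) •
      ρ (i.removeNth fun j => (w j).1) (w i).2)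

theorem liftFun_alternating {r : ℕ} (μ : g [⋀^Fin (r + 2)]→ₗ[K] g)
    (ρ : g [⋀^Fin (r + 1)]→ₗ[K] Module.End K V) :
    ∃ φ : (g × V) [⋀^Fin (r + 2)]→ₗ[K] (g × V), ∀ w, φ w = liftFun μ ρ w := by
  let F : (g × V) →ₗ[K] (g × V) [⋀^Fin (r + 1)]→ₗ[K] V :=
    { toFun := fun w => ((LinearMap.applyₗ w.2 : Module.End K V →ₗ[K] V).compAlternatingMap
        ρ).compLinearMap (LinearMap.fst K g V)
      map_add' := fun a b => by ext; simp
      map_smul' := fun c a => by ext; simp }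
  refine ⟨(LinearMap.inl K g V).compAlternatingMap (μ.compLinearMap (LinearMap.fst K g V)) +
    (-1 : K) ^ (r + 1) • (LinearMap.inr K g V).compAlternatingMap
      (AlternatingMap.alternatizeUncurryFin F), fun w => ?_⟩
  have h : ∀ i : Fin (r + 2), (-1 : K) ^ (r + 1) * (-1) ^ (i : ℕ) = (-1) ^ (r + 1 - (i : ℕ)) := by
    intro i
    have hi : (r + 1 - (i : ℕ)) + i = r + 1 := by omega
    conv_lhs => rw [← hi, pow_add, mul_assoc, ← pow_add, ← two_mul, pow_mul]
    simp
  refine Prod.ext ?_ ?_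
  · simp [liftFun]
  · simp only [AlternatingMap.add_apply, AlternatingMap.smul_apply,
      LinearMap.compAlternatingMap_apply, LinearMap.inl_apply, LinearMap.inr_apply, Prod.snd_add,
      Prod.smul_snd, zero_add, AlternatingMap.alternatizeUncurryFin_apply, liftFun,
      Finset.smul_sum]
    refine Finset.sum_congr rfl fun i _ => ?_
    rw [← h i, mul_smul]
    congr 1
    rcases Nat.even_or_odd (i : ℕ) with hi | hi <;> simp [hi.neg_one_pow, F] <;> rfl

theorem alternating_isCochain {W : Type*} [AddCommGroup W] [Module K W] {N : ℕ}
    (φ : W [⋀^Fin (N + 1)]→ₗ[K] W) :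
    IsCochain K fun (X : Fin 1 → Fin N → W) (x : W) => φ (Fin.snoc (α := fun _ => W) (X 0) x) := by
  have h0 : ∀ i : Fin 1, i = 0 := fun i => Subsingleton.elim _ _
  refine ⟨⟨fun X x i a => ?_, fun X => ?_⟩, fun X x i a b hab h => ?_, fun X x i a _ h => ?_⟩
  · rw [h0 i]
    simp only [Function.update_self, Fin.snoc_update]
    exact ⟨fun u v => φ.map_update_add _ _ _ _, fun c u => φ.map_update_smul _ _ _ _⟩
  · have h1 : ∀ u, (Fin.snoc (α := fun _ => W) (X 0) u : Fin (N + 1) → W) =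
        Function.update (Fin.snoc (α := fun _ => W) (X 0) 0) (Fin.last N) u := by
      intro u; rw [Fin.update_snoc_last]
    have h2 : (fun u => φ (Fin.snoc (α := fun _ => W) (X 0) u)) = fun u =>
        φ (Function.update (Fin.snoc (α := fun _ => W) (X 0) 0) (Fin.last N) u) :=
      funext fun u => congrArg φ (h1 u)
    change IsLinearMap K fun u => φ (Fin.snoc (α := fun _ => W) (X 0) u)
    rw [h2]
    exact ⟨fun u v => φ.map_update_add _ _ _ _, fun c u => φ.map_update_smul _ _ _ _⟩
  · rw [h0 i] at h
    exact φ.map_eq_zero_of_eq _ (i := a.castSucc) (j := b.castSucc) (by simpa using h)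
      (by simpa using hab)
  · rw [h0 i] at h
    exact φ.map_eq_zero_of_eq _ (i := a.castSucc) (j := Fin.last N) (by simpa using h)
      (Fin.castSucc_lt_last a).ne

/-- The lift of `μ` and `ρ` as an element `μ + ρ` of `C^1(g ⊕ V, g ⊕ V)`. -/
def pairCochain {r : ℕ} (μ : g [⋀^Fin (r + 2)]→ₗ[K] g)
    (ρ : g [⋀^Fin (r + 1)]→ₗ[K] Module.End K V) : Cochain K (g × V) (r + 1) 1 :=
  ⟨fun X x => liftFun μ ρ (Fin.snoc (α := fun _ => g × V) (X 0) x), by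
    obtain ⟨φ, hφ⟩ := liftFun_alternating μ ρ
    have := alternating_isCochain φ
    simp only [hφ] at this
    exact this⟩

theorem pairCochain_mem {r : ℕ} (μ : g [⋀^Fin (r + 2)]→ₗ[K] g)
    (ρ : g [⋀^Fin (r + 1)]→ₗ[K] Module.End K V) :
    pairCochain μ ρ ∈ bidegreeSubmodule K g V (r + 1) 1 := by
  refine ⟨by simp, fun S X x hS => ?_⟩
  have hcard : S.card + Sᶜ.card = r + 2 := by
    rw [Finset.card_add_card_compl]; simp
  set w : Fin (r + 2) → g × V := Fin.snoc (α := fun _ => g × V) (X 0) x with hw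
  have hval : (pairCochain μ ρ).1 X x = liftFun μ ρ w := rfl
  have hT : ∀ o : Option (Fin 1 × Fin (r + 1)), ∃ i, args X x o = w i ∧
      i = Option.elim o (Fin.last (r + 1)) fun ia => ia.2.castSucc := by
    rintro (_ | ⟨i, a⟩)
    · exact ⟨_, by simp [args, hw], rfl⟩
    · have : i = 0 := Subsingleton.elim _ _
      subst this
      exact ⟨_, by simp [args, hw], rfl⟩
  have hz1 : ∀ o, o ∉ S → (w (Option.elim o (Fin.last (r + 1)) fun ia => ia.2.castSucc)).1 = 0 := by
    intro o ho
    obtain ⟨i, h1, h2⟩ := hT o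
    rw [← h2, ← h1]
    exact (hS o).2 ho
  have hμ : Sᶜ.card ≠ 0 → (liftFun μ ρ w).1 = 0 := by
    intro h
    obtain ⟨o, ho⟩ := Finset.card_ne_zero.mp h
    exact μ.map_coord_zero _ (hz1 o (by simpa using ho))
  rw [hval]
  refine ⟨fun h => ?_, fun h => ?_, fun h1 h2 => ?_⟩
  · have hS' : ∀ o, o ∈ S := by
      have : Sᶜ = ∅ := Finset.card_eq_zero.mp (by have := h.2; omega)
      intro o
      by_contra ho
      have : o ∈ Sᶜ := by simpa using ho
      simp_all
    change ∑ i : Fin (r + 2), (-1 : K) ^ (r + 1 - (i : ℕ)) •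
      ρ (i.removeNth fun j => (w j).1) (w i).2 = 0
    refine Finset.sum_eq_zero fun i _ => ?_
    have : (w i).2 = 0 := by
      refine Fin.lastCases ?_ (fun a => ?_) i
      · have := (hS none).1 (hS' _)
        simpa [args, hw] using this
      · have := (hS (some (0, a))).1 (hS' _)
        simpa [args, hw] using this
    rw [this, map_zero, smul_zero]
  · exact hμ (by have := h.2; omega)
  · have h3 : 1 < Sᶜ.card := by
      push_cast at h1 h2
      omega
    obtain ⟨o, ho, o', ho', hne⟩ := Finset.one_lt_card.mp h3
    have hne' : (Option.elim o (Fin.last (r + 1)) fun ia => ia.2.castSucc) ≠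
        (Option.elim o' (Fin.last (r + 1)) fun ia => ia.2.castSucc) := by
      rcases o with _ | ⟨i, a⟩ <;> rcases o' with _ | ⟨i', a'⟩
      · exact absurd rfl hne
      · exact (Fin.castSucc_lt_last a').ne'
      · exact (Fin.castSucc_lt_last a).ne
      · have : i = i' := Subsingleton.elim _ _
        subst this
        intro h
        apply hne
        simpa using h
    refine Prod.ext (hμ (by omega)) ?_
    change ∑ i : Fin (r + 2), (-1 : K) ^ (r + 1 - (i : ℕ)) •
      ρ (i.removeNth fun j => (w j).1) (w i).2 = 0
    refine Finset.sum_eq_zero fun i _ => ?_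
    have : ∃ j, j ≠ i ∧ (w j).1 = 0 := by
      by_cases hi : (Option.elim o (Fin.last (r + 1)) fun ia => ia.2.castSucc) = i
      · exact ⟨_, hi ▸ hne'.symm, hz1 o' (by simpa using ho')⟩
      · exact ⟨_, hi, hz1 o (by simpa using ho)⟩
    obtain ⟨j, hji, hj⟩ := this
    obtain ⟨t, rfl⟩ := Fin.exists_succAbove_eq hji
    rw [ρ.map_coord_zero (m := i.removeNth fun j => (w j).1) t hj]
    simp

/-- The element `μ + ρ` of `⨁ k, C^{k(n-1)|0}(g ⊕ V, g ⊕ V)`, for `n = r + 2`. -/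
noncomputable def pairElement {r : ℕ} (μ : g [⋀^Fin (r + 2)]→ₗ[K] g)
    (ρ : g [⋀^Fin (r + 1)]→ₗ[K] Module.End K V) : ⨁ k, BidegreeCochain K g V (r + 1) k :=
  DirectSum.lof K ℕ (fun k => BidegreeCochain K g V (r + 1) k) 1 ⟨pairCochain μ ρ, pairCochain_mem μ ρ⟩

end Pairs

end NLie

namespace NLie

section SubsetComposition

variable {ι W : Type*} {N : ℕ}

/-- The argument positions of a function of the blocks indexed by `A` and of one further vector
(`none`). -/
def slots (N : ℕ) (A : Finset ι) : Finset (Option (ι × Fin N)) :=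
  Finset.insertNone (A ×ˢ Finset.univ)

theorem none_mem_slots (A : Finset ι) : none ∈ slots N A := by simp [slots]

theorem some_mem_slots {A : Finset ι} {j : ι} {i : Fin N} : some (j, i) ∈ slots N A ↔ j ∈ A := by
  simp [slots]

variable [LinearOrder ι]

/-- All blocks of `S` come before the position `o`; the position `none` is the last one. -/
def Before (S : Finset ι) (o : Option (ι × Fin N)) : Prop := ∀ a ∈ o, ∀ s ∈ S, s < a.1

theorem before_none (S : Finset ι) : Before S (none : Option (ι × Fin N)) := by simp [Before]

theorem before_some {S : Finset ι} {j : ι} {i : Fin N} :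
    Before S (some (j, i)) ↔ ∀ s ∈ S, s < j := by simp [Before]

theorem before_union {S T : Finset ι} {o : Option (ι × Fin N)} :
    Before (S ∪ T) o ↔ Before S o ∧ Before T o := by
  simp only [Before, Finset.mem_union]
  exact ⟨fun h => ⟨fun a ha s hs => h a ha s (.inl hs), fun a ha s hs => h a ha s (.inr hs)⟩,
    fun h a ha s hs => hs.elim (h.1 a ha s) (h.2 a ha s)⟩

/-- The sign of the permutation which moves the blocks of `S` in front of those of `T`. -/
def moveSign (S T : Finset ι) : ℤ := (-1) ^ ((S ×ˢ T).filter fun x => x.2 < x.1).card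

theorem moveSign_union_left {S S' T : Finset ι} (h : Disjoint S S') :
    moveSign (S ∪ S') T = moveSign S T * moveSign S' T := by
  unfold moveSign
  rw [Finset.union_product, Finset.filter_union, Finset.card_union_of_disjoint, pow_add]
  refine Finset.disjoint_filter_filter (Finset.disjoint_product.mpr (.inl h))

theorem moveSign_union_right {S T T' : Finset ι} (h : Disjoint T T') :
    moveSign S (T ∪ T') = moveSign S T * moveSign S T' := by
  unfold moveSign
  rw [Finset.product_union, Finset.filter_union, Finset.card_union_of_disjoint, pow_add]
  refine Finset.disjoint_filter_filter (Finset.disjoint_product.mpr (.inr h))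

theorem moveSign_comm {S T : Finset ι} (h : Disjoint S T) :
    moveSign S T = (-1) ^ (S.card * T.card) * moveSign T S := by
  have h1 : ((S ×ˢ T).filter fun x => x.2 < x.1).card +
      ((T ×ˢ S).filter fun x => x.2 < x.1).card = S.card * T.card := by
    rw [← Finset.card_product, ← Finset.card_filter_add_card_filter_not
      (s := S ×ˢ T) (fun x => x.2 < x.1)]
    congr 1
    refine Finset.card_bij (fun x _ => x.swap) ?_ ?_ ?_
    · rintro ⟨a, b⟩ hx
      simp only [Finset.mem_filter, Finset.mem_product, Prod.swap] at hx ⊢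
      exact ⟨hx.1.symm, not_lt.mpr hx.2.le⟩
    · intro x _ y _ hxy
      exact Prod.swap_injective hxy
    · rintro ⟨a, b⟩ hx
      simp only [Finset.mem_filter, Finset.mem_product, not_lt] at hx
      refine ⟨(b, a), ?_, rfl⟩
      simp only [Finset.mem_filter, Finset.mem_product]
      exact ⟨hx.1.symm, lt_of_le_of_ne hx.2 fun e => Finset.disjoint_left.mp h hx.1.1 (e ▸ hx.1.2)⟩
  unfold moveSign
  rw [← h1, pow_add, mul_assoc, ← pow_add, ← two_mul, pow_mul]
  simp

variable [AddCommGroup W]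

/-- A family of functions of the blocks indexed by finite sets and of one further vector, each
depending only on its own arguments, and additive in each of them. -/
structure IsLocal (F : Finset ι → (Option (ι × Fin N) → W) → W) : Prop where
  congr : ∀ (A : Finset ι) (Z Z' : Option (ι × Fin N) → W),
    (∀ o ∈ slots N A, Z o = Z' o) → F A Z = F A Z'
  add : ∀ (A : Finset ι) (Z : Option (ι × Fin N) → W), ∀ o ∈ slots N A, ∀ u v : W,
    F A (Function.update Z o (u + v)) = F A (Function.update Z o u) + F A (Function.update Z o v)

namespace IsLocal

variable {F : Finset ι → (Option (ι × Fin N) → W) → W}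

/-- The additive map in one argument. -/
def hom (hF : IsLocal F) (A : Finset ι) (Z : Option (ι × Fin N) → W) (o : Option (ι × Fin N))
    (ho : o ∈ slots N A) : W →+ W :=
  AddMonoidHom.mk' (fun u => F A (Function.update Z o u)) (hF.add A Z o ho)

theorem zero (hF : IsLocal F) {A : Finset ι} (Z : Option (ι × Fin N) → W)
    {o : Option (ι × Fin N)} (ho : o ∈ slots N A) : F A (Function.update Z o 0) = 0 :=
  (hF.hom A Z o ho).map_zero

theorem zsmul (hF : IsLocal F) {A : Finset ι} (Z : Option (ι × Fin N) → W)
    {o : Option (ι × Fin N)} (ho : o ∈ slots N A) (c : ℤ) (u : W) :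
    F A (Function.update Z o (c • u)) = c • F A (Function.update Z o u) :=
  (hF.hom A Z o ho).map_zsmul c u

theorem sum (hF : IsLocal F) {A : Finset ι} (Z : Option (ι × Fin N) → W)
    {o : Option (ι × Fin N)} (ho : o ∈ slots N A) {α : Type*} (s : Finset α) (f : α → W) :
    F A (Function.update Z o (∑ i ∈ s, f i)) = ∑ i ∈ s, F A (Function.update Z o (f i)) :=
  map_sum (hF.hom A Z o ho) f s

theorem update_of_notMem (hF : IsLocal F) {A : Finset ι} (Z : Option (ι × Fin N) → W)
    {o : Option (ι × Fin N)} (ho : o ∉ slots N A) (u : W) : F A (Function.update Z o u) = F A Z :=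
  hF.congr A _ _ fun o' ho' => Function.update_of_ne (fun e => ho (by rwa [← e])) _ _

end IsLocal

/-- The vector `y` in the position `o` is replaced by the value of `G` on the blocks of `S`
and `y`. -/
def insertAt (G : Finset ι → (Option (ι × Fin N) → W) → W) (S : Finset ι)
    (o : Option (ι × Fin N)) (Z : Option (ι × Fin N) → W) : Option (ι × Fin N) → W :=
  Function.update Z o (G S (Function.update Z none (Z o)))

open scoped Classical in
/-- The composition of families of functions which corresponds to `circ`, as a sum over subsets. -/
noncomputable def comp (F G : Finset ι → (Option (ι × Fin N) → W) → W) :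
    Finset ι → (Option (ι × Fin N) → W) → W := fun A Z =>
  ∑ S ∈ A.powerset, moveSign S (A \ S) •
    ∑ o ∈ (slots N (A \ S)).filter (Before S), F (A \ S) (insertAt G S o Z)

open scoped Classical in
/-- The part of `comp (comp F G) H` in which `G` and `H` act on different arguments of `F`. -/
noncomputable def associator (F G H : Finset ι → (Option (ι × Fin N) → W) → W) :
    Finset ι → (Option (ι × Fin N) → W) → W := fun A Z =>
  ∑ T ∈ A.powerset, ∑ S ∈ (A \ T).powerset,
    (moveSign T (A \ T) * moveSign S ((A \ T) \ S)) •
      ∑ o' ∈ (slots N ((A \ T) \ S)).filter (Before S),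
        ∑ o ∈ ((slots N ((A \ T) \ S)).filter (Before T)).erase o',
          F ((A \ T) \ S) (Function.update
            (Function.update Z o (H T (Function.update Z none (Z o)))) o'
            (G S (Function.update Z none (Z o'))))

theorem sum_powerset_powerset {M : Type*} [AddCommMonoid M] (A : Finset ι)
    (f : Finset ι → Finset ι → M) :
    ∑ U ∈ A.powerset, ∑ T ∈ U.powerset, f U T =
      ∑ T ∈ A.powerset, ∑ S ∈ (A \ T).powerset, f (T ∪ S) T := by
  rw [Finset.sum_sigma', Finset.sum_sigma']
  refine Finset.sum_bij' (fun x _ => ⟨x.2, x.1 \ x.2⟩) (fun x _ => ⟨x.1 ∪ x.2, x.1⟩) ?_ ?_ ?_ ?_ ?_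
  · rintro ⟨U, T⟩ h
    simp only [Finset.mem_sigma, Finset.mem_powerset] at h ⊢
    exact ⟨h.2.trans h.1, Finset.sdiff_subset_sdiff h.1 le_rfl⟩
  · rintro ⟨T, S⟩ h
    simp only [Finset.mem_sigma, Finset.mem_powerset] at h ⊢
    exact ⟨Finset.union_subset h.1 (h.2.trans Finset.sdiff_subset), Finset.subset_union_left⟩
  · rintro ⟨U, T⟩ h
    simp only [Finset.mem_sigma, Finset.mem_powerset] at h
    simp [Finset.union_sdiff_of_subset h.2]
  · rintro ⟨T, S⟩ h
    simp only [Finset.mem_sigma, Finset.mem_powerset] at h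
    have : Disjoint T S := Finset.disjoint_of_subset_right h.2 Finset.disjoint_sdiff
    simp [Finset.union_sdiff_cancel_left this]
  · rintro ⟨U, T⟩ h
    simp only [Finset.mem_sigma, Finset.mem_powerset] at h
    simp [Finset.union_sdiff_of_subset h.2]

theorem associator_comm {F G H : Finset ι → (Option (ι × Fin N) → W) → W} {q r : ℕ}
    (hF : IsLocal F) (hG : ∀ A Z, A.card ≠ q → G A Z = 0) (hH : ∀ A Z, A.card ≠ r → H A Z = 0)
    (A : Finset ι) (Z : Option (ι × Fin N) → W) :
    associator F G H A Z = (-1 : ℤ) ^ (q * r) • associator F H G A Z := by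
  classical
  unfold associator
  rw [Finset.sum_comm' (t' := A.powerset) (s' := fun S => (A \ S).powerset)]
  swap
  · intro S T
    simp only [Finset.mem_powerset, Finset.subset_sdiff]
    exact ⟨fun h => ⟨⟨h.1, h.2.2.symm⟩, h.2.1⟩, fun h => ⟨h.1.1, h.2, h.1.2.symm⟩⟩
  rw [Finset.smul_sum]
  refine Finset.sum_congr rfl fun S hS => ?_
  rw [Finset.smul_sum]
  refine Finset.sum_congr rfl fun T hT => ?_
  rw [Finset.mem_powerset, Finset.subset_sdiff] at hT
  rw [Finset.mem_powerset] at hS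
  have hR : (A \ T) \ S = (A \ S) \ T := by rw [sdiff_sdiff_comm]
  rw [smul_smul, ← hR]
  set R := (A \ T) \ S with hRdef
  by_cases hc : S.card = q ∧ T.card = r
  · have hTS : A \ T = S ∪ R := by
      rw [hRdef, Finset.union_sdiff_of_subset (Finset.subset_sdiff.mpr ⟨hS, hT.2.symm⟩)]
    have hST : A \ S = T ∪ R := by
      rw [hR, Finset.union_sdiff_of_subset (Finset.subset_sdiff.mpr hT)]
    have d1 : Disjoint S R := Finset.disjoint_sdiff
    have d2 : Disjoint T R := by rw [hR]; exact Finset.disjoint_sdiff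
    have hsign : moveSign T (A \ T) * moveSign S R =
        (-1) ^ (q * r) * (moveSign S (A \ S) * moveSign T R) := by
      rw [hTS, hST, moveSign_union_right d1, moveSign_union_right d2, moveSign_comm hT.2, hc.1,
        hc.2, mul_comm r q]
      ring
    rw [hsign]
    congr 1
    rw [Finset.sum_comm' (t' := (slots N R).filter (Before T))
      (s' := fun o => ((slots N R).filter (Before S)).erase o)]
    · refine Finset.sum_congr rfl fun o ho => Finset.sum_congr rfl fun o' ho' => ?_
      rw [Function.update_comm (Finset.ne_of_mem_erase ho').symm]
    · intro o o'
      simp only [Finset.mem_erase, Finset.mem_filter]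
      exact ⟨fun h => ⟨⟨h.2.1.symm, h.1⟩, h.2.2⟩, fun h => ⟨h.1.2, h.1.1.symm, h.2⟩⟩
  · have hz : ∀ o ∈ slots N R, ∀ o' ∈ slots N R, o' ≠ o → F R (Function.update
            (Function.update Z o (H T (Function.update Z none (Z o)))) o'
            (G S (Function.update Z none (Z o')))) = 0 := by
      intro o ho o' ho' hne
      rcases not_and_or.mp hc with h | h
      · rw [hG S _ h, hF.zero _ ho']
      · rw [hH T _ h, Function.update_comm hne.symm, hF.zero _ ho]
    rw [Finset.sum_eq_zero, smul_zero, Finset.sum_eq_zero, smul_zero]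
    · intro o ho
      refine Finset.sum_eq_zero fun o' ho' => ?_
      simp only [Finset.mem_erase, Finset.mem_filter] at ho ho'
      rw [Function.update_comm ho'.1]
      exact hz o ho.1 o' ho'.2.1 ho'.1
    · intro o' ho'
      refine Finset.sum_eq_zero fun o ho => ?_
      simp only [Finset.mem_erase, Finset.mem_filter] at ho ho'
      exact hz o ho.2.1 o' ho'.1 ho.1.symm

end SubsetComposition

section PreLie

variable {ι W : Type*} {N : ℕ} [LinearOrder ι] [AddCommGroup W]
  {F G H : Finset ι → (Option (ι × Fin N) → W) → W}

theorem update_insertAt_of_ne (hG : IsLocal G) {S T : Finset ι} {o o' : Option (ι × Fin N)}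
    (hne : o' ≠ o) (ho : o = none ∨ o ∉ slots N S) (Z : Option (ι × Fin N) → W) :
    insertAt G S o' (insertAt H T o Z) = Function.update
      (Function.update Z o (H T (Function.update Z none (Z o)))) o'
      (G S (Function.update Z none (Z o'))) := by
  unfold insertAt
  rw [Function.update_of_ne hne]
  congr 1
  rcases ho with rfl | ho
  · rw [Function.update_idem]
  · have h0 : none ≠ o := fun e => ho (e ▸ none_mem_slots S)
    rw [Function.update_comm h0.symm, hG.update_of_notMem _ ho]

theorem insertAt_insertAt_self (hG : IsLocal G) {S T : Finset ι} {o : Option (ι × Fin N)}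
    (ho : o = none ∨ o ∉ slots N S) (Z : Option (ι × Fin N) → W) :
    insertAt G S o (insertAt H T o Z) =
      Function.update Z o (G S (insertAt H T none (Function.update Z none (Z o)))) := by
  unfold insertAt
  simp only [Function.update_self, Function.update_idem]
  rcases ho with rfl | ho
  · rw [Function.update_idem]
  · have h0 : none ≠ o := fun e => ho (e ▸ none_mem_slots S)
    rw [Function.update_comm h0.symm, hG.update_of_notMem _ ho]

theorem insertAt_insertAt_of_notMem (hF : IsLocal F) {R S T : Finset ι}
    {o o' : Option (ι × Fin N)} (hne : o' ≠ o) (h0 : o ≠ none) (ho : o ∉ slots N R)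
    (Z : Option (ι × Fin N) → W) :
    F R (insertAt G S o' (insertAt H T o Z)) =
      F R (Function.update Z o' (G S (insertAt H T o (Function.update Z none (Z o'))))) := by
  unfold insertAt
  rw [Function.update_of_ne hne, Function.update_comm hne.symm, hF.update_of_notMem _ ho,
    Function.update_of_ne h0, Function.update_comm h0, Function.update_idem]

open scoped Classical in
theorem comp_comp_left (A : Finset ι) (Z : Option (ι × Fin N) → W) :
    comp (comp F G) H A Z = ∑ T ∈ A.powerset, ∑ S ∈ (A \ T).powerset,
      (moveSign T (A \ T) * moveSign S ((A \ T) \ S)) •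
      ∑ o' ∈ (slots N ((A \ T) \ S)).filter (Before S),
        ∑ o ∈ (slots N (A \ T)).filter (Before T),
          F ((A \ T) \ S) (insertAt G S o' (insertAt H T o Z)) := by
  simp only [comp]
  refine Finset.sum_congr rfl fun T _ => ?_
  rw [Finset.sum_comm, Finset.smul_sum]
  refine Finset.sum_congr rfl fun S _ => ?_
  rw [← Finset.smul_sum, smul_smul, Finset.sum_comm]

open scoped Classical in
theorem comp_comp_right (hF : IsLocal F) (A : Finset ι) (Z : Option (ι × Fin N) → W) :
    comp F (comp G H) A Z = ∑ T ∈ A.powerset, ∑ S ∈ (A \ T).powerset,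
      (moveSign T (A \ T) * moveSign S ((A \ T) \ S)) •
      ∑ o' ∈ (slots N ((A \ T) \ S)).filter (Before (T ∪ S)),
        ∑ o ∈ (slots N S).filter (Before T),
          F ((A \ T) \ S) (Function.update Z o'
            (G S (insertAt H T o (Function.update Z none (Z o'))))) := by
  have h1 : comp F (comp G H) A Z = ∑ U ∈ A.powerset, ∑ T ∈ U.powerset,
      (moveSign U (A \ U) * moveSign T (U \ T)) •
      ∑ o' ∈ (slots N (A \ U)).filter (Before U),
        ∑ o ∈ (slots N (U \ T)).filter (Before T),
          F (A \ U) (Function.update Z o'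
            (G (U \ T) (insertAt H T o (Function.update Z none (Z o'))))) := by
    unfold comp
    refine Finset.sum_congr rfl fun U _ => ?_
    rw [Finset.sum_congr rfl (fun T _ => mul_smul _ _ _), ← Finset.smul_sum]
    simp only [Finset.smul_sum (s := Finset.filter _ _) (f := fun o' => Finset.sum _ _)]
    rw [Finset.sum_comm]
    congr 1
    refine Finset.sum_congr rfl fun o' ho' => ?_
    rw [Finset.mem_filter] at ho'
    rw [insertAt, hF.sum _ ho'.1]
    refine Finset.sum_congr rfl fun T _ => ?_
    rw [hF.zsmul _ ho'.1, hF.sum _ ho'.1]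
  rw [h1, sum_powerset_powerset]
  refine Finset.sum_congr rfl fun T hT => Finset.sum_congr rfl fun S hS => ?_
  rw [Finset.mem_powerset] at hT
  rw [Finset.mem_powerset, Finset.subset_sdiff] at hS
  have h2 : (T ∪ S) \ T = S := Finset.union_sdiff_cancel_left hS.2.symm
  have h3 : A \ (T ∪ S) = (A \ T) \ S := by rw [sdiff_sdiff_left]; rfl
  have h4 : A \ T = S ∪ (A \ T) \ S := by
    rw [Finset.union_sdiff_of_subset (Finset.subset_sdiff.mpr hS)]
  rw [h2, h3]
  congr 1
  conv_rhs => rw [h4, moveSign_union_right Finset.disjoint_sdiff, ← h4]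
  rw [moveSign_union_left hS.2.symm]
  ring

/-- The associator of the composition: the terms in which `G` and `H` are nested cancel. -/
theorem comp_comp (hF : IsLocal F) (hG : IsLocal G) (A : Finset ι)
    (Z : Option (ι × Fin N) → W) :
    comp (comp F G) H A Z = comp F (comp G H) A Z + associator F G H A Z := by
  classical
  rw [comp_comp_left, comp_comp_right hF, associator, ← Finset.sum_add_distrib]
  refine Finset.sum_congr rfl fun T hT => ?_
  rw [← Finset.sum_add_distrib]
  refine Finset.sum_congr rfl fun S hS => ?_
  rw [← smul_add]
  congr 1
  rw [Finset.mem_powerset] at hS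
  set R := (A \ T) \ S with hRdef
  have hAT : A \ T = S ∪ R := by rw [hRdef, Finset.union_sdiff_of_subset hS]
  have hSR : Disjoint S R := Finset.disjoint_sdiff
  have hsplit : (slots N (A \ T)).filter (Before T) =
      (((slots N S).filter (Before T)).erase none) ∪ (slots N R).filter (Before T) := by
    ext o
    rcases o with _ | ⟨j, i⟩
    · simp [none_mem_slots, before_none]
    · simp only [Finset.mem_filter, Finset.mem_union, Finset.mem_erase, some_mem_slots, hAT]
      simp [or_and_right]
  have hmem : ∀ o ∈ ((slots N S).filter (Before T)).erase none, o ≠ none ∧ o ∉ slots N R := by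
    rintro (_ | ⟨j, i⟩) ho
    · simp at ho
    · simp only [Finset.mem_erase, Finset.mem_filter, some_mem_slots] at ho ⊢
      exact ⟨ho.1, Finset.disjoint_left.mp hSR ho.2.1⟩
  have hdisj : Disjoint (((slots N S).filter (Before T)).erase none)
      ((slots N R).filter (Before T)) :=
    Finset.disjoint_left.mpr fun o ho ho' => (hmem o ho).2 (Finset.mem_filter.mp ho').1
  rw [hsplit]
  have hfil : (slots N R).filter (Before (T ∪ S)) =
      ((slots N R).filter (Before S)).filter (Before T) := by
    ext o
    simp only [Finset.mem_filter, before_union]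
    tauto
  rw [hfil, Finset.sum_filter (s := (slots N R).filter (Before S)), ← Finset.sum_add_distrib]
  refine Finset.sum_congr rfl fun o' ho' => ?_
  rw [Finset.mem_filter] at ho'
  rw [Finset.sum_union hdisj]
  have hdiff : ∀ o ∈ ((slots N R).filter (Before T)).erase o',
      F R (insertAt G S o' (insertAt H T o Z)) = F R (Function.update
            (Function.update Z o (H T (Function.update Z none (Z o)))) o'
            (G S (Function.update Z none (Z o')))) := by
    intro o ho
    simp only [Finset.mem_erase, Finset.mem_filter] at ho
    rw [update_insertAt_of_ne hG ho.1.symm]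
    rcases o with _ | ⟨j, i⟩
    · exact .inl rfl
    · refine .inr ?_
      rw [some_mem_slots] at ho ⊢
      exact Finset.disjoint_right.mp hSR ho.2.1
  have hin : ∀ o ∈ ((slots N S).filter (Before T)).erase none,
      F R (insertAt G S o' (insertAt H T o Z)) =
        F R (Function.update Z o' (G S (insertAt H T o (Function.update Z none (Z o'))))) :=
    fun o ho => insertAt_insertAt_of_notMem hF (fun e => (hmem o ho).2 (by rw [← e]; exact ho'.1))
      (hmem o ho).1 (hmem o ho).2 Z
  have hself : o' = none ∨ o' ∉ slots N S := by
    rcases o' with _ | ⟨j, i⟩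
    · exact .inl rfl
    · refine .inr ?_
      rw [some_mem_slots] at ho' ⊢
      exact Finset.disjoint_right.mp hSR ho'.1
  by_cases hT' : Before T o'
  · rw [if_pos hT', ← Finset.add_sum_erase ((slots N R).filter (Before T)) _
      (Finset.mem_filter.mpr ⟨ho'.1, hT'⟩), Finset.sum_congr rfl hdiff, Finset.sum_congr rfl hin,
      ← Finset.add_sum_erase ((slots N S).filter (Before T)) _
      (Finset.mem_filter.mpr ⟨none_mem_slots S, before_none T⟩), insertAt_insertAt_self hG hself]
    abel
  · rw [if_neg hT', zero_add]
    have hempty : ((slots N S).filter (Before T)).erase none = ∅ := by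
      rw [Finset.eq_empty_iff_forall_notMem]
      rintro (_ | ⟨j, i⟩) ho
      · simp at ho
      · simp only [Finset.mem_erase, Finset.mem_filter, some_mem_slots, before_some] at ho
        exact hT' fun a ha t ht => (ho.2.2 t ht).trans (ho'.2 a ha j ho.2.1)
    rw [hempty, Finset.sum_empty, zero_add,
      ← Finset.sum_congr rfl hdiff, Finset.erase_eq_of_notMem]
    exact fun h => hT' (Finset.mem_filter.mp h).2

end PreLie

section ShuffleSums

variable {p q : ℕ}

/-- The increasing enumeration of a subset with `q` elements. -/
def enum (S : {S : Finset (Fin (p + q)) // S.card = q}) : Fin q → Fin (p + q) :=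
  S.1.orderEmbOfFin S.2

/-- The increasing enumeration of the complement of a subset with `q` elements. -/
def coenum (S : {S : Finset (Fin (p + q)) // S.card = q}) : Fin p → Fin (p + q) :=
  S.1ᶜ.orderEmbOfFin (by rw [Finset.card_compl, S.2, Fintype.card_fin, Nat.add_sub_cancel])

section Enum

variable (S : {S : Finset (Fin (p + q)) // S.card = q})

theorem enum_strictMono : StrictMono (enum S) := (S.1.orderEmbOfFin S.2).strictMono

theorem coenum_strictMono : StrictMono (coenum S) :=
  (S.1ᶜ.orderEmbOfFin (by
    rw [Finset.card_compl, S.2, Fintype.card_fin, Nat.add_sub_cancel])).strictMono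

theorem image_enum : Finset.univ.image (enum S) = S.1 := Finset.image_orderEmbOfFin_univ _ _

theorem image_coenum : Finset.univ.image (coenum S) = S.1ᶜ := Finset.image_orderEmbOfFin_univ _ _

theorem coenum_or_enum (j : Fin (p + q)) : (∃ a, coenum S a = j) ∨ ∃ b, enum S b = j := by
  by_cases h : j ∈ S.1
  · rw [← image_enum S] at h
    exact .inr (by simpa using h)
  · rw [← Finset.mem_compl, ← image_coenum S] at h
    exact .inl (by simpa using h)

theorem coenum_of_forall_lt {a : Fin p} (h : ∀ b, enum S b < coenum S a) :
    coenum S a = a.addNat q := by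
  have h1 : Finset.Iio (coenum S a) = S.1 ∪ (Finset.Iio a).image (coenum S) := by
    ext j
    simp only [Finset.mem_Iio, Finset.mem_union, Finset.mem_image]
    constructor
    · intro hj
      rcases coenum_or_enum S j with ⟨a', rfl⟩ | ⟨b, rfl⟩
      · exact .inr ⟨a', (coenum_strictMono S).lt_iff_lt.mp hj, rfl⟩
      · exact .inl (Finset.orderEmbOfFin_mem _ _ _)
    · rintro (hj | ⟨a', ha', rfl⟩)
      · rw [← image_enum S] at hj
        obtain ⟨b, -, rfl⟩ := Finset.mem_image.mp hj
        exact h b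
      · exact coenum_strictMono S ha'
  have h2 : Disjoint S.1 ((Finset.Iio a).image (coenum S)) := by
    rw [Finset.disjoint_left]
    intro j hj hj'
    obtain ⟨a', -, rfl⟩ := Finset.mem_image.mp hj'
    have : coenum S a' ∈ S.1ᶜ := Finset.orderEmbOfFin_mem _ _ _
    exact (Finset.mem_compl.mp this) hj
  have h3 := congrArg Finset.card h1
  rw [Finset.card_union_of_disjoint h2, S.2,
    Finset.card_image_of_injective _ (coenum_strictMono S).injective, Fin.card_Iio,
    Fin.card_Iio] at h3
  ext
  rw [h3, Fin.val_addNat, add_comm]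

theorem moveSign_eq_prod {ι : Type*} [LinearOrder ι] (S T : Finset ι) :
    moveSign S T = ∏ s ∈ S, ∏ t ∈ T, if t < s then -1 else 1 := by
  rw [← Finset.prod_product', Finset.prod_ite, Finset.prod_const, Finset.prod_const_one, mul_one]
  rfl

theorem moveSign_compl : moveSign S.1 S.1ᶜ =
    ∏ b : Fin q, ∏ a : Fin p, if coenum S a < enum S b then -1 else 1 := by
  rw [moveSign_eq_prod, ← image_coenum S]
  conv_lhs => rw [← image_enum S]
  rw [Finset.prod_image (enum_strictMono S).injective.injOn]
  refine Finset.prod_congr rfl fun b _ => ?_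
  rw [Finset.prod_image (coenum_strictMono S).injective.injOn]

theorem enum_eq {f : Fin q → Fin (p + q)} (hf : StrictMono f)
    (h : Finset.univ.image f = S.1) : enum S = f :=
  (Finset.orderEmbOfFin_unique S.2 (fun x => by simp [← h]) hf).symm

theorem coenum_eq {f : Fin p → Fin (p + q)} (hf : StrictMono f)
    (h : ∀ a, f a ∉ S.1) : coenum S = f :=
  (Finset.orderEmbOfFin_unique _ (fun x => by simp [h]) hf).symm

end Enum

/-- The positions which remain in front of and behind the last block moved by a shuffle. -/
def front (k : ℕ) (σ : Equiv.Perm (Fin (p + q))) : Fin p → Fin (p + q) := fun a =>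
  if (a : ℕ) < k then σ (Fin.castAdd q a) else a.addNat q

/-- The positions moved by a shuffle to `{k, …, k + q - 1}`. -/
def back {k : ℕ} (hk : k ≤ p) (σ : Equiv.Perm (Fin (p + q))) : Fin q → Fin (p + q) := fun b =>
  σ ⟨k + b, by omega⟩

theorem shuffle_lt {k : ℕ} {σ : Equiv.Perm (Fin (p + q))}
    (hσ : ∀ a : Fin (p + q), k + q ≤ (a : ℕ) → σ a = a) {a : Fin (p + q)}
    (ha : (a : ℕ) < k + q) : (σ a : ℕ) < k + q := by
  by_contra h
  have := σ.injective (hσ (σ a) (not_lt.mp h))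
  rw [this] at h
  exact h ha

theorem front_strictMono {k : ℕ} {σ : Equiv.Perm (Fin (p + q))}
    (hσ : σ ∈ shuffles (p + q) k q) : StrictMono (front (p := p) k σ) := by
  have hfix := mem_shuffles_fix hσ
  simp only [shuffles, Finset.mem_filter, Finset.mem_univ, true_and] at hσ
  intro a b hab
  unfold front
  have hab' : (a : ℕ) < b := hab
  split_ifs with h1 h2 h2
  · exact hσ.1 _ _ hab' h2
  · rw [Fin.lt_def]
    have := shuffle_lt hfix (a := Fin.castAdd q a) (by simp; omega)
    simp only [Fin.val_addNat]
    omega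
  · omega
  · rw [Fin.lt_def, Fin.val_addNat, Fin.val_addNat]
    omega

theorem back_strictMono {k : ℕ} (hk : k ≤ p) {σ : Equiv.Perm (Fin (p + q))}
    (hσ : σ ∈ shuffles (p + q) k q) : StrictMono (back hk σ) := by
  simp only [shuffles, Finset.mem_filter, Finset.mem_univ, true_and] at hσ
  intro a b hab
  exact hσ.2.1 _ _ (by simp) (by rw [Fin.lt_def] at hab ⊢; simpa using hab) (by simp)

/-- The subset of positions moved by a shuffle to `{k, …, k + q - 1}`. -/
def backSet {k : ℕ} (hk : k ≤ p) (σ : Equiv.Perm (Fin (p + q))) :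
    {S : Finset (Fin (p + q)) // S.card = q} :=
  ⟨Finset.univ.image (back hk σ), by
    rw [Finset.card_image_of_injective, Finset.card_univ, Fintype.card_fin]
    exact fun a b h => by simpa [Fin.ext_iff, back] using h⟩

theorem enum_backSet {k : ℕ} (hk : k ≤ p) {σ : Equiv.Perm (Fin (p + q))}
    (hσ : σ ∈ shuffles (p + q) k q) : enum (backSet hk σ) = back hk σ :=
  enum_eq _ (back_strictMono hk hσ) rfl

theorem coenum_backSet {k : ℕ} (hk : k ≤ p) {σ : Equiv.Perm (Fin (p + q))}
    (hσ : σ ∈ shuffles (p + q) k q) : coenum (backSet hk σ) = front k σ := by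
  refine coenum_eq _ (front_strictMono hσ) fun a h => ?_
  obtain ⟨b, -, hb⟩ := Finset.mem_image.mp h
  exact shuffle_disjoint hk (mem_shuffles_fix hσ) a b hb.symm

theorem back_lt_front {k : ℕ} (hk : k ≤ p) {σ : Equiv.Perm (Fin (p + q))}
    (hσ : σ ∈ shuffles (p + q) k q) {a : Fin p} (ha : k ≤ (a : ℕ)) (b : Fin q) :
    back hk σ b < front k σ a := by
  unfold front
  rw [if_neg (not_lt.mpr ha), Fin.lt_def]
  have := shuffle_lt (mem_shuffles_fix hσ) (a := ⟨k + b, by omega⟩) (by simp)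
  simp only [Fin.val_addNat, back]
  omega

theorem sign_shuffle {k : ℕ} (hk : k ≤ p) {σ : Equiv.Perm (Fin (p + q))}
    (hσ : σ ∈ shuffles (p + q) k q) :
    (Equiv.Perm.sign σ : ℤ) = ∏ x ∈ (Finset.univ.filter fun a : Fin p => (a : ℕ) < k) ×ˢ
      (Finset.univ : Finset (Fin q)), if front k σ x.1 < back hk σ x.2 then 1 else -1 := by
  have hfix := mem_shuffles_fix hσ
  have hσ' := hσ
  simp only [shuffles, Finset.mem_filter, Finset.mem_univ, true_and] at hσ'
  rw [Equiv.Perm.sign_eq_prod_prod_Iio, Finset.prod_sigma', Units.coe_prod]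
  symm
  refine Finset.prod_of_injOn (fun x => ⟨⟨k + x.2, by omega⟩, Fin.castAdd q x.1⟩) ?_ ?_ ?_ ?_
  · rintro ⟨a, b⟩ - ⟨a', b'⟩ - h
    simp only [Sigma.mk.injEq, Fin.mk.injEq, heq_eq_eq, add_right_inj] at h
    exact Prod.ext (Fin.castAdd_injective _ _ h.2) (Fin.ext h.1)
  · rintro ⟨a, b⟩ h
    simp only [Finset.coe_product, Finset.coe_filter, Set.mem_prod, Set.mem_ofPred_eq,
      Finset.mem_univ, true_and] at h
    simp [Fin.lt_def]
    omega
  · rintro ⟨j, i⟩ hji hn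
    simp only [Finset.mem_sigma, Finset.mem_univ, Finset.mem_Iio, true_and] at hji
    have hij : (i : ℕ) < j := hji
    rw [if_pos, Units.val_one]
    by_cases hj : (j : ℕ) < k + q
    · by_cases hjk : (j : ℕ) < k
      · exact hσ'.1 i j hji hjk
      · by_cases hik : k ≤ (i : ℕ)
        · exact hσ'.2.1 i j hik hji hj
        · refine absurd ⟨(⟨i, by omega⟩, ⟨j - k, by omega⟩), ?_, ?_⟩ hn
          · simp; omega
          · have : (⟨k + (j - k), by omega⟩ : Fin (p + q)) = j := by ext; simp; omega
            simp only [Fin.castAdd_mk, this]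
    · rw [hfix j (not_lt.mp hj)]
      by_cases hi : (i : ℕ) < k + q
      · have := shuffle_lt hfix hi
        rw [Fin.lt_def]
        exact this.trans_le (not_lt.mp hj)
      · rw [hfix i (not_lt.mp hi)]; exact hji
  · rintro ⟨a, b⟩ h
    simp only [Finset.mem_product, Finset.mem_filter, Finset.mem_univ, true_and, and_true] at h
    simp only [front, back, h, if_true]
    split_ifs <;> rfl

theorem moveSign_backSet {k : ℕ} (hk : k ≤ p) {σ : Equiv.Perm (Fin (p + q))}
    (hσ : σ ∈ shuffles (p + q) k q) :
    moveSign (backSet hk σ).1 (backSet hk σ).1ᶜ = (-1) ^ (k * q) * (Equiv.Perm.sign σ : ℤ) := by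
  have hcard : ((Finset.univ.filter fun a : Fin p => (a : ℕ) < k) ×ˢ
      (Finset.univ : Finset (Fin q))).card = k * q := by
    rw [Finset.card_product, Finset.card_univ, Fintype.card_fin, Fin.card_filter_val_lt,
      min_eq_right hk]
  rw [moveSign_compl, enum_backSet hk hσ, coenum_backSet hk hσ, sign_shuffle hk hσ, ← hcard,
    ← Finset.prod_const, ← Finset.prod_mul_distrib, Finset.prod_comm, Finset.prod_product,
    Finset.prod_filter]
  refine Finset.prod_congr rfl fun a _ => ?_
  split_ifs with ha
  · refine Finset.prod_congr rfl fun b _ => ?_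
    split_ifs <;> rfl
  · refine Finset.prod_eq_one fun b _ => ?_
    rw [if_neg (back_lt_front hk hσ (not_lt.mp ha) b).not_gt]

theorem backSet_injOn {k : ℕ} (hk : k ≤ p) {σ τ : Equiv.Perm (Fin (p + q))}
    (hσ : σ ∈ shuffles (p + q) k q) (hτ : τ ∈ shuffles (p + q) k q)
    (h : backSet hk σ = backSet hk τ) : σ = τ := by
  have h1 : back hk σ = back hk τ := by rw [← enum_backSet hk hσ, h, enum_backSet hk hτ]
  have h2 : front (p := p) k σ = front k τ := by
    rw [← coenum_backSet hk hσ, h, coenum_backSet hk hτ]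
  ext s
  by_cases hs : (s : ℕ) < k
  · have := congrFun h2 ⟨s, by omega⟩
    simp only [front, hs, if_true] at this
    exact congrArg Fin.val this
  · by_cases hs' : (s : ℕ) < k + q
    · have := congrFun h1 ⟨s - k, by omega⟩
      have e : (⟨k + (s - k), by omega⟩ : Fin (p + q)) = s := by ext; simp; omega
      simp only [back, e] at this
      exact congrArg Fin.val this
    · rw [mem_shuffles_fix hσ s (not_lt.mp hs'), mem_shuffles_fix hτ s (not_lt.mp hs')]

theorem exists_backSet_eq (S : {S : Finset (Fin (p + q)) // S.card = q}) {k : ℕ} (hk : k ≤ p)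
    (h : ∀ a : Fin p, k ≤ (a : ℕ) → ∀ b, enum S b < coenum S a) :
    ∃ σ ∈ shuffles (p + q) k q, backSet hk σ = S := by
  let f : Fin (p + q) → Fin (p + q) := fun s =>
    if hs : (s : ℕ) < k then coenum S ⟨s, by omega⟩
    else if hs' : (s : ℕ) < k + q then enum S ⟨s - k, by omega⟩ else s
  have f1 : ∀ s : Fin (p + q), ∀ hs : (s : ℕ) < k, f s = coenum S ⟨s, by omega⟩ :=
    fun s hs => dif_pos hs
  have f2 : ∀ (s : Fin (p + q)) (hs : k ≤ (s : ℕ)) (hs' : (s : ℕ) < k + q),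
      f s = enum S ⟨s - k, by omega⟩ := fun s hs hs' => by
    simp only [f]
    rw [dif_neg (not_lt.mpr hs), dif_pos hs']
  have f3 : ∀ s : Fin (p + q), k + q ≤ (s : ℕ) → f s = s := fun s hs => by
    have : ¬ (s : ℕ) < k := by omega
    simp only [f, dif_neg (not_lt.mpr hs), dif_neg this]
  have hf : Function.Surjective f := by
    intro j
    rcases coenum_or_enum S j with ⟨a, rfl⟩ | ⟨b, rfl⟩
    · by_cases ha : (a : ℕ) < k
      · exact ⟨Fin.castAdd q a, f1 _ ha⟩
      · refine ⟨coenum S a, f3 _ ?_⟩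
        rw [coenum_of_forall_lt S (h a (not_lt.mp ha)), Fin.val_addNat]
        omega
    · refine ⟨⟨k + b, by omega⟩, ?_⟩
      rw [f2 _ (by simp) (by simp)]
      congr 1
      ext; simp
  obtain ⟨σ, hσ⟩ : ∃ σ : Equiv.Perm (Fin (p + q)), ∀ s, σ s = f s :=
    ⟨Equiv.ofBijective f ⟨Finite.injective_iff_surjective.mpr hf, hf⟩, fun _ => rfl⟩
  refine ⟨σ, ?_, ?_⟩
  · simp only [shuffles, Finset.mem_filter, Finset.mem_univ, true_and, hσ]
    refine ⟨fun a b hab hb => ?_, fun a b ha hab hb => ?_, f3⟩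
    · rw [Fin.lt_def] at hab
      rw [f1 a (by omega), f1 b hb]
      exact coenum_strictMono S hab
    · rw [Fin.lt_def] at hab
      rw [f2 a ha (by omega), f2 b (by omega) hb]
      exact enum_strictMono S (by rw [Fin.lt_def]; simp; omega)
  · refine Subtype.ext ?_
    rw [← image_enum S]
    change Finset.image (back hk _) Finset.univ = _
    refine Finset.image_congr fun b _ => ?_
    rw [back, hσ, f2 _ (by simp) (by simp)]
    congr 1
    ext; simp

/-- A signed sum over shuffles, as a signed sum over subsets. -/
theorem sum_shuffles {W : Type*} [AddCommGroup W] {k : ℕ} (hk : k ≤ p)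
    (Φ : (Fin p → Fin (p + q)) → (Fin q → Fin (p + q)) → W) :
    ∑ σ ∈ shuffles (p + q) k q, ((-1) ^ (k * q) * (Equiv.Perm.sign σ : ℤ)) •
      Φ (front k σ) (back hk σ) =
    ∑ S : {S : Finset (Fin (p + q)) // S.card = q},
      if ∀ a : Fin p, k ≤ (a : ℕ) → ∀ b, enum S b < coenum S a then
        moveSign S.1 S.1ᶜ • Φ (coenum S) (enum S) else 0 := by
  rw [← Finset.sum_filter]
  refine Finset.sum_bij (fun σ _ => backSet hk σ) ?_ ?_ ?_ ?_
  · intro σ hσ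
    rw [Finset.mem_filter, enum_backSet hk hσ, coenum_backSet hk hσ]
    exact ⟨Finset.mem_univ _, fun a ha b => back_lt_front hk hσ ha b⟩
  · intro σ hσ τ hτ h
    exact backSet_injOn hk hσ hτ h
  · intro S hS
    obtain ⟨σ, hσ, h⟩ := exists_backSet_eq S hk (Finset.mem_filter.mp hS).2
    exact ⟨σ, hσ, h⟩
  · intro σ hσ
    rw [moveSign_backSet hk hσ, enum_backSet hk hσ, coenum_backSet hk hσ]

end ShuffleSums

section Extension

variable {W : Type*} {N p q : ℕ}

theorem forall_enum_lt_iff (S : {S : Finset (Fin (p + q)) // S.card = q}) (k : Fin p) :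
    (∀ a : Fin p, (k : ℕ) ≤ (a : ℕ) → ∀ b, enum S b < coenum S a) ↔
      ∀ s ∈ S.1, s < coenum S k := by
  constructor
  · intro h s hs
    rw [← image_enum S] at hs
    obtain ⟨b, -, rfl⟩ := Finset.mem_image.mp hs
    exact h k le_rfl b
  · intro h a ha b
    exact (h _ (Finset.orderEmbOfFin_mem _ _ _)).trans_le ((coenum_strictMono S).monotone ha)

theorem sum_slots {ι M : Type*} [AddCommMonoid M] (A : Finset ι) (φ : Option (ι × Fin N) → M) :
    ∑ o ∈ slots N A, φ o = φ none + ∑ j ∈ A, ∑ i, φ (some (j, i)) := by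
  rw [slots, Finset.sum_insertNone, Finset.sum_product]

theorem update_some_comp {ι : Type*} [DecidableEq ι] {m : ℕ} {e : Fin m → ι}
    (he : Function.Injective e) (Z : Option (ι × Fin N) → W) (a : Fin m) (i : Fin N) (u : W) :
    (fun a' i' => Function.update Z (some (e a, i)) u (some (e a', i'))) =
      Function.update (fun a' i' => Z (some (e a', i'))) a
        (Function.update (fun i' => Z (some (e a, i'))) i u) := by
  funext a' i'
  by_cases h : a' = a
  · subst h
    by_cases h' : i' = i
    · subst h'; simp
    · simp [h']
  · simp [h, he.ne h]

variable [AddCommGroup W]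

/-- `circ` as a signed sum over subsets. -/
theorem circ_eq_sum_subsets (P : (Fin p → Fin N → W) → W → W) (Q : (Fin q → Fin N → W) → W → W)
    (X : Fin (p + q) → Fin N → W) (x : W) :
    circ P Q X x = ∑ S : {S : Finset (Fin (p + q)) // S.card = q}, moveSign S.1 S.1ᶜ •
      (outerTerm P Q (coenum S) (enum S) X x + ∑ k : Fin p, if ∀ s ∈ S.1, s < coenum S k then
        ∑ i : Fin N, innerTerm P Q (coenum S) (enum S) k i X x else 0) := by
  rw [circ_eq]
  simp only [Pi.add_apply, Finset.sum_apply, Pi.smul_apply, smul_add, Finset.sum_add_distrib,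
    Finset.smul_sum (s := (Finset.univ : Finset (Fin p)))]
  rw [add_comm]
  congr 1
  · rw [show (∑ σ ∈ shuffles (p + q) p q, ((-1) ^ (p * q) * (Equiv.Perm.sign σ : ℤ)) •
      outerTerm P Q (fun a : Fin p => if (a : ℕ) < p then σ (Fin.castAdd q a) else a.addNat q)
        (fun b : Fin q => σ ⟨p + b, by omega⟩) X x) = _ from
      sum_shuffles le_rfl fun c d => outerTerm P Q c d X x]
    refine Finset.sum_congr rfl fun S _ => if_pos fun a ha => absurd ha (not_le.mpr a.isLt)
  · rw [Finset.sum_comm]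
    refine Finset.sum_congr rfl fun k _ => ?_
    rw [show (∑ σ ∈ shuffles (p + q) k q, ((-1) ^ ((k : ℕ) * q) * (Equiv.Perm.sign σ : ℤ)) •
      ∑ i, innerTerm P Q (fun a : Fin p => if (a : ℕ) < k then σ (Fin.castAdd q a) else a.addNat q)
        (fun b : Fin q => σ ⟨k + b, by omega⟩) k i X x) = _ from
      sum_shuffles k.isLt.le fun c d => ∑ i, innerTerm P Q c d k i X x]
    refine Finset.sum_congr rfl fun S _ => ?_
    rw [smul_ite, smul_zero]
    exact if_congr (forall_enum_lt_iff S k) rfl rfl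

variable {ι : Type*} [LinearOrder ι]

/-- A function of `m` blocks and one vector, as a function of the blocks in a finite set with `m`
elements, in increasing order. -/
def extend {m : ℕ} (f : (Fin m → Fin N → W) → W → W) :
    Finset ι → (Option (ι × Fin N) → W) → W := fun A Z =>
  if h : A.card = m then f (fun a i => Z (some (A.orderEmbOfFin h a, i))) (Z none) else 0

theorem extend_of_card {m : ℕ} (f : (Fin m → Fin N → W) → W → W) {A : Finset ι}
    (h : A.card = m) (Z : Option (ι × Fin N) → W) :
    extend f A Z = f (fun a i => Z (some (A.orderEmbOfFin h a, i))) (Z none) := dif_pos h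

theorem extend_of_card_ne {m : ℕ} (f : (Fin m → Fin N → W) → W → W) (A : Finset ι)
    (Z : Option (ι × Fin N) → W) (h : A.card ≠ m) : extend f A Z = 0 := dif_neg h

theorem extend_eq {m : ℕ} (f : (Fin m → Fin N → W) → W → W) {A : Finset ι} {e : Fin m → ι}
    (he : StrictMono e) (h : Finset.univ.image e = A) (Z : Option (ι × Fin N) → W) :
    extend f A Z = f (fun a i => Z (some (e a, i))) (Z none) := by
  have hc : A.card = m := by
    rw [← h, Finset.card_image_of_injective _ he.injective, Finset.card_univ, Fintype.card_fin]
  rw [extend_of_card f hc, ← Finset.orderEmbOfFin_unique hc (fun x => by simp [← h]) he]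

theorem extend_isLocal {K : Type*} [Field K] [Module K W] {m : ℕ}
    {f : (Fin m → Fin N → W) → W → W} (hf : IsBlockMultilinear K f) :
    IsLocal (extend (ι := ι) f) := by
  refine ⟨fun A Z Z' h => ?_, fun A Z o ho u v => ?_⟩
  · by_cases hA : A.card = m
    · rw [extend_of_card f hA, extend_of_card f hA, h none (none_mem_slots A)]
      congr 1
      funext a i
      exact h _ (some_mem_slots.mpr (Finset.orderEmbOfFin_mem _ _ _))
    · rw [extend_of_card_ne f A _ hA, extend_of_card_ne f A _ hA]
  · by_cases hA : A.card = m
    · rw [extend_of_card f hA, extend_of_card f hA, extend_of_card f hA]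
      rcases o with _ | ⟨j, i⟩
      · simp only [Function.update_self, Function.update_of_ne (Option.some_ne_none _)]
        exact (hf.linear_last _).map_add u v
      · rw [some_mem_slots, ← Finset.image_orderEmbOfFin_univ A hA] at ho
        obtain ⟨a, -, rfl⟩ := Finset.mem_image.mp ho
        simp only [update_some_comp (A.orderEmbOfFin hA).injective,
          Function.update_of_ne (Option.some_ne_none _).symm]
        exact (hf.linear_block _ _ a i).map_add u v
    · simp [extend_of_card_ne f A _ hA]

theorem moveSign_map {κ : Type*} [LinearOrder κ] (e : κ ↪o ι) (S T : Finset κ) :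
    moveSign (S.map e.toEmbedding) (T.map e.toEmbedding) = moveSign S T := by
  rw [moveSign_eq_prod, moveSign_eq_prod, Finset.prod_map]
  refine Finset.prod_congr rfl fun s _ => ?_
  rw [Finset.prod_map]
  refine Finset.prod_congr rfl fun t _ => ?_
  simp

theorem extend_circ {K : Type*} [Field K] [Module K W] {P : (Fin p → Fin N → W) → W → W}
    (hP : IsBlockMultilinear K P) (Q : (Fin q → Fin N → W) → W → W) :
    extend (ι := ι) (circ P Q) = comp (extend P) (extend Q) := by
  classical
  funext A Z
  by_cases hA : A.card = p + q
  · set e := A.orderEmbOfFin hA with he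
    have hAe : A = Finset.univ.map e.toEmbedding := (Finset.map_orderEmbOfFin_univ A hA).symm
    rw [extend_of_card _ hA, circ_eq_sum_subsets, ← he]
    have hcomp : comp (extend P) (extend Q) A Z =
        ∑ S ∈ (Finset.univ : Finset (Fin (p + q))).powersetCard q,
          moveSign (S.map e.toEmbedding) (A \ S.map e.toEmbedding) •
          ∑ o ∈ (slots N (A \ S.map e.toEmbedding)).filter (Before (S.map e.toEmbedding)),
            extend P (A \ S.map e.toEmbedding) (insertAt (extend Q) (S.map e.toEmbedding) o Z) := by
      unfold comp
      refine Eq.trans ?_ (Finset.sum_map (Finset.univ.powersetCard q)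
        (Finset.mapEmbedding e.toEmbedding).toEmbedding (fun S => moveSign S (A \ S) •
          ∑ o ∈ (slots N (A \ S)).filter (Before S), extend P (A \ S) (insertAt (extend Q) S o Z)))
      rw [← Finset.powersetCard_map, ← hAe]
      symm
      refine Finset.sum_subset (fun S hS => Finset.mem_powerset.mpr
        (Finset.mem_powersetCard.mp hS).1) fun S hS hS' => ?_
      rw [Finset.sum_eq_zero, smul_zero]
      intro o ho
      rw [insertAt, extend_of_card_ne Q S _ fun h => hS'
        (Finset.mem_powersetCard.mpr ⟨Finset.mem_powerset.mp hS, h⟩)]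
      exact (extend_isLocal hP).zero Z (Finset.mem_filter.mp ho).1
    rw [hcomp, Finset.sum_subtype (p := fun S => S.card = q)
      ((Finset.univ : Finset (Fin (p + q))).powersetCard q) (fun S => by simp)]
    refine Finset.sum_congr rfl fun S _ => ?_
    have hcompl : A \ S.1.map e.toEmbedding = S.1ᶜ.map e.toEmbedding := by
      rw [Finset.compl_eq_univ_sdiff, Finset.map_sdiff, ← hAe]
    have hc : StrictMono fun a => e (coenum S a) := e.strictMono.comp (coenum_strictMono S)
    have hd : StrictMono fun b => e (enum S b) := e.strictMono.comp (enum_strictMono S)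
    have hci : Finset.univ.image (fun a => e (coenum S a)) = S.1ᶜ.map e.toEmbedding := by
      rw [← image_coenum S, Finset.map_eq_image, Finset.image_image]; rfl
    have hdi : Finset.univ.image (fun b => e (enum S b)) = S.1.map e.toEmbedding := by
      rw [← image_enum S, Finset.map_eq_image, Finset.image_image]; rfl
    rw [hcompl, moveSign_map, Finset.sum_filter, sum_slots, if_pos (before_none _), ← hci,
      Finset.sum_image hc.injective.injOn, hci]
    congr 2
    · rw [extend_eq P hc hci, insertAt, extend_eq Q hd hdi]
      simp [outerTerm]
    · refine Finset.sum_congr rfl fun k _ => ?_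
      have hbef : ∀ i : Fin N, Before (S.1.map e.toEmbedding) (some (e (coenum S k), i)) ↔
          ∀ s ∈ S.1, s < coenum S k := by
        intro i
        rw [before_some]
        simp
      simp only [hbef]
      split_ifs
      · refine Finset.sum_congr rfl fun i _ => ?_
        rw [extend_eq P hc hci, insertAt, extend_eq Q hd hdi,
          update_some_comp (e := fun a => e (coenum S a)) hc.injective]
        simp [innerTerm]
      · simp
  · rw [extend_of_card_ne _ A _ hA]
    symm
    refine Finset.sum_eq_zero fun S hS => ?_
    rw [Finset.mem_powerset] at hS
    rw [Finset.sum_eq_zero, smul_zero]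
    intro o ho
    by_cases hq : S.card = q
    · refine extend_of_card_ne P _ _ fun h => hA ?_
      rw [← h, ← hq, Finset.card_sdiff_add_card_eq_card hS]
    · rw [insertAt, extend_of_card_ne Q S _ hq]
      exact (extend_isLocal hP).zero Z (Finset.mem_filter.mp ho).1

end Extension

section GradedLieBracket

variable {K W : Type*} [Field K] [AddCommGroup W] [Module K W] {N p q : ℕ}

variable (K W N) in
/-- All cochains, as families of functions indexed by finite sets of natural numbers. -/
noncomputable def extendLin :
    (⨁ m, Cochain K W N m) →ₗ[K] Finset ℕ → (Option (ℕ × Fin N) → W) → W :=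
  DirectSum.toModule K ℕ _ fun m =>
    { toFun := fun f => extend f.1
      map_add' := fun f f' => by
        funext A Z
        by_cases h : A.card = m
        · simp only [Pi.add_apply, extend_of_card _ h]; rfl
        · simp only [Pi.add_apply, extend_of_card_ne _ A Z h, add_zero]
      map_smul' := fun c f => by
        funext A Z
        by_cases h : A.card = m
        · simp only [Pi.smul_apply, extend_of_card _ h]; rfl
        · simp only [Pi.smul_apply, extend_of_card_ne _ A Z h, smul_zero] }

theorem extendLin_lof (m : ℕ) (f : Cochain K W N m) :
    extendLin K W N (DirectSum.lof K ℕ (fun m => Cochain K W N m) m f) = extend f.1 :=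
  DirectSum.toModule_lof K m f

theorem extendLin_apply (α : ⨁ m, Cochain K W N m) (A : Finset ℕ)
    (Z : Option (ℕ × Fin N) → W) : extendLin K W N α A Z = extend (α A.card).1 A Z := by
  induction α using DirectSum.induction_on with
  | zero =>
    rw [map_zero]
    simp only [DirectSum.zero_apply, extend_of_card _ rfl]
    rfl
  | of m f =>
    change extendLin K W N (DirectSum.lof K ℕ (fun m => Cochain K W N m) m f) A Z = _
    rw [extendLin_lof]
    by_cases h : A.card = m
    · subst h
      rw [DirectSum.of_eq_same]
    · rw [extend_of_card_ne _ A Z h, DirectSum.of_eq_of_ne _ _ _ h, extend_of_card _ rfl]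
      rfl
  | add a b ha hb =>
    rw [map_add, Pi.add_apply, Pi.add_apply, ha, hb, DirectSum.add_apply]
    simp only [extend_of_card _ rfl]
    rfl

theorem extendLin_injective : Function.Injective (extendLin K W N) := by
  rw [← LinearMap.ker_eq_bot, LinearMap.ker_eq_bot']
  intro α hα
  refine DFinsupp.ext fun m => Subtype.ext ?_
  funext X x
  have h := congrFun (congrFun hα (Finset.range m)) fun o =>
    Option.elim o x fun ji => if h : ji.1 < m then X ⟨ji.1, h⟩ ji.2 else 0
  rw [extendLin_apply, Finset.card_range] at h
  rw [extend_eq (α m).1 (e := fun a : Fin m => (a : ℕ)) (fun a b h => h)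
    (by ext j; simp only [Finset.mem_image, Finset.mem_univ, true_and, Finset.mem_range]
        exact ⟨fun ⟨a, ha⟩ => ha ▸ a.isLt, fun h => ⟨⟨j, h⟩, rfl⟩⟩)] at h
  change (α m).1 (fun a i => X a i) x = 0
  simpa using h

theorem extend_circLin (P : Cochain K W N p) (Q : Cochain K W N q) :
    extend (ι := ℕ) (circLin K W N p q P Q).1 = comp (extend P.1) (extend Q.1) :=
  extend_circ P.2.toIsBlockMultilinear Q.1

theorem lof_cast {m m' : ℕ} (h : m = m') (f : Cochain K W N m) :
    DirectSum.lof K ℕ (fun m => Cochain K W N m) m f =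
      DirectSum.lof K ℕ (fun m => Cochain K W N m) m' (h ▸ f) := by
  subst h; rfl

theorem nLieBracket_lof_eq_lof (P : Cochain K W N p) (Q : Cochain K W N q) :
    nLieBracket K W N (DirectSum.lof K ℕ (fun m => Cochain K W N m) p P)
      (DirectSum.lof K ℕ (fun m => Cochain K W N m) q Q) =
    DirectSum.lof K ℕ (fun m => Cochain K W N m) (p + q) (circLin K W N p q P Q -
      (-1 : K) ^ (p * q) • ((add_comm q p) ▸ circLin K W N q p Q P : Cochain K W N (p + q))) := by
  rw [nLieBracket_lof, map_sub, map_smul, lof_cast (add_comm q p)]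

theorem nLieBracket_isGradedLieBracket : IsGradedLieBracket (nLieBracket K W N) where
  degree p q P Q := ⟨_, nLieBracket_lof_eq_lof P Q⟩
  skew p q P Q := by
    rw [nLieBracket_lof, nLieBracket_lof, mul_comm q p, smul_sub, smul_smul, ← pow_add,
      ← two_mul, pow_mul]
    simp
  jacobi p q s P Q R := by
    apply extendLin_injective
    have hloc : ∀ {m : ℕ} (f : Cochain K W N m), IsLocal (extend (ι := ℕ) f.1) := fun f =>
      extend_isLocal f.2.toIsBlockMultilinear
    have hassoc : ∀ {a b c : ℕ} (A : Cochain K W N a) (B : Cochain K W N b) (C : Cochain K W N c),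
        comp (comp (extend (ι := ℕ) A.1) (extend B.1)) (extend C.1) =
        comp (extend A.1) (comp (extend B.1) (extend C.1)) +
          associator (extend A.1) (extend B.1) (extend C.1) := fun A B C => by
      funext S Z
      exact comp_comp (hloc A) (hloc B) S Z
    have hcomm : ∀ {a b c : ℕ} (A : Cochain K W N a) (B : Cochain K W N b) (C : Cochain K W N c),
        associator (extend (ι := ℕ) A.1) (extend B.1) (extend C.1) =
        (-1 : K) ^ (b * c) • associator (extend A.1) (extend C.1) (extend B.1) := by
      intro a b c A B C
      funext S Z
      rw [associator_comm (hloc A) (extend_of_card_ne B.1) (extend_of_card_ne C.1)]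
      simp only [Pi.smul_apply]
      rcases Nat.even_or_odd (b * c) with h | h <;> simp [h.neg_one_pow]
    simp only [nLieBracket_lof, map_sub, map_smul, map_add, LinearMap.sub_apply,
      LinearMap.smul_apply, extendLin_lof, extend_circLin, hassoc]
    rw [hcomm P R Q, hcomm Q R P, hcomm R Q P]
    simp only [mul_add, add_mul, pow_add, mul_comm q p, mul_comm s p, mul_comm s q]
    rcases neg_one_pow_eq_or K (p * q) with h1 | h1 <;>
    rcases neg_one_pow_eq_or K (p * s) with h2 | h2 <;>
    rcases neg_one_pow_eq_or K (q * s) with h3 | h3 <;>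
    · rw [h1, h2, h3]
      module

end GradedLieBracket

section Multilinear

variable {K W : Type*} [Field K] [AddCommGroup W] [Module K W] {m N p q : ℕ}

/-- A multilinear function of blocks and one vector as a multilinear map. -/
def IsBlockMultilinear.toMultilinearMap {f : (Fin m → Fin N → W) → W → W}
    (hf : IsBlockMultilinear K f) : MultilinearMap K (fun _ : Option (Fin m × Fin N) => W) W where
  toFun Z := f (fun i a => Z (some (i, a))) (Z none)
  map_update_add' {inst} Z o u v := by
    obtain rfl : inst = Option.instDecidableEq := Subsingleton.elim _ _
    rcases o with _ | ⟨i, a⟩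
    · simp only [Function.update_self, Function.update_of_ne (Option.some_ne_none _)]
      exact (hf.linear_last _).map_add u v
    · have hu : ∀ w, (fun i' a' => Function.update Z (some (i, a)) w (some (i', a'))) =
          Function.update (fun i' a' => Z (some (i', a'))) i
            (Function.update (fun a' => Z (some (i, a'))) a w) := fun w =>
        update_some_comp (e := id) Function.injective_id Z i a w
      simp only [hu, Function.update_of_ne (Option.some_ne_none _).symm]
      exact (hf.linear_block (fun i a => Z (some (i, a))) _ i a).map_add u v
  map_update_smul' {inst} Z o c u := by
    obtain rfl : inst = Option.instDecidableEq := Subsingleton.elim _ _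
    rcases o with _ | ⟨i, a⟩
    · simp only [Function.update_self, Function.update_of_ne (Option.some_ne_none _)]
      exact (hf.linear_last _).map_smul c u
    · have hu : ∀ w, (fun i' a' => Function.update Z (some (i, a)) w (some (i', a'))) =
          Function.update (fun i' a' => Z (some (i', a'))) i
            (Function.update (fun a' => Z (some (i, a'))) a w) := fun w =>
        update_some_comp (e := id) Function.injective_id Z i a w
      simp only [hu, Function.update_of_ne (Option.some_ne_none _).symm]
      exact (hf.linear_block (fun i a => Z (some (i, a))) _ i a).map_smul c u

theorem circ_map {P : (Fin p → Fin N → W) → W → W} {Q : (Fin q → Fin N → W) → W → W}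
    (φ : W →ₗ[K] W) (hP : ∀ X x, P (fun i a => φ (X i a)) (φ x) = φ (P X x))
    (hQ : ∀ X x, Q (fun i a => φ (X i a)) (φ x) = φ (Q X x))
    (X : Fin (p + q) → Fin N → W) (x : W) :
    circ P Q (fun i a => φ (X i a)) (φ x) = φ (circ P Q X x) := by
  have hupd : ∀ (Y : Fin p → Fin N → W) (k : Fin p) (B : Fin N → W) (i : Fin N) (u : W),
      Function.update (fun a i => φ (Y a i)) k (Function.update (fun i => φ (B i)) i (φ u)) =
      fun a j => φ (Function.update Y k (Function.update B i u) a j) := by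
    intro Y k B i u
    funext a j
    by_cases h : a = k
    · subst h
      by_cases h' : j = i
      · subst h'; simp
      · simp [h']
    · simp [h]
  rw [circ_eq]
  simp only [Pi.add_apply, Finset.sum_apply, Pi.smul_apply, map_add, map_sum, map_zsmul,
    innerTerm, outerTerm, hQ, hupd, hP]

end Multilinear

section BidegreeClosed

variable {K g V : Type*} [Field K] [AddCommGroup g] [Module K g] [AddCommGroup V] [Module K V]
  {m N p q : ℕ}

theorem hasType_iff {S : Finset (Option (Fin m × Fin N))}
    {Z : Option (Fin m × Fin N) → g × V} :
    HasType S (fun i a => Z (some (i, a))) (Z none) ↔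
      ∀ o, (o ∈ S → (Z o).2 = 0) ∧ (o ∉ S → (Z o).1 = 0) := by
  have : args (fun i a => Z (some (i, a))) (Z none) = Z := by
    funext o; rcases o with _ | o <;> rfl
  rw [HasType, this]

/-- Multilinear maps which agree on families of vectors of `g` and of `V` are equal. -/
theorem multilinearMap_ext_of_hasType {ι E : Type*} [Finite ι] [AddCommGroup E] [Module K E]
    {M M' : MultilinearMap K (fun _ : ι => g × V) E}
    (h : ∀ (S : Finset ι) (Z : ι → g × V),
      (∀ o, (o ∈ S → (Z o).2 = 0) ∧ (o ∉ S → (Z o).1 = 0)) → M Z = M' Z) : M = M' := by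
  classical
  have := Fintype.ofFinite ι
  refine MultilinearMap.ext fun Z => ?_
  have hZ : Z = (fun o => ((Z o).1, (0 : V))) + fun o => ((0 : g), (Z o).2) := by
    funext o; simp
  rw [hZ, MultilinearMap.map_add_univ, MultilinearMap.map_add_univ]
  refine Finset.sum_congr rfl fun S _ => h S _ fun o => ⟨fun ho => ?_, fun ho => ?_⟩
  · simp [ho]
  · simp [ho]

variable (K g V) in
/-- The identity of `g` and twice the identity of `V`. -/
def weightMap : g × V →ₗ[K] g × V := LinearMap.prodMap LinearMap.id ((2 : K) • LinearMap.id)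

theorem weightMap_apply (w : g × V) : weightMap K g V w = (w.1, (2 : K) • w.2) := rfl

theorem map_weightMap_of_hasType {ι E : Type*} [Fintype ι] [DecidableEq ι] [AddCommGroup E]
    [Module K E] (M : MultilinearMap K (fun _ : ι => g × V) E) {S : Finset ι} {Z : ι → g × V}
    (h : ∀ o, (o ∈ S → (Z o).2 = 0) ∧ (o ∉ S → (Z o).1 = 0)) :
    M (fun o => weightMap K g V (Z o)) = (2 : K) ^ Sᶜ.card • M Z := by
  have h1 : (fun o => weightMap K g V (Z o)) = fun o => (if o ∈ S then (1 : K) else 2) • Z o := by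
    funext o
    rw [weightMap_apply]
    split_ifs with ho
    · rw [(h o).1 ho]
      refine Prod.ext ?_ ?_ <;> simp [(h o).1 ho]
    · refine Prod.ext ?_ ?_ <;> simp [(h o).2 ho]
  rw [h1, MultilinearMap.map_smul_univ]
  congr 1
  rw [Finset.prod_ite, Finset.prod_const_one, one_mul, Finset.prod_const]
  congr 2
  ext o; simp

/-- A multilinear function has bidegree `m(n-1)|0` if and only if it commutes with `weightMap`. -/
theorem hasBidegree_iff [CharZero K] {f : (Fin m → Fin N → g × V) → g × V → g × V}
    (hf : IsBlockMultilinear K f) : HasBidegree (m * N) 0 f ↔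
      ∀ X x, f (fun i a => weightMap K g V (X i a)) (weightMap K g V x) =
        weightMap K g V (f X x) := by
  have hcard : ∀ S : Finset (Option (Fin m × Fin N)), (S.card : ℤ) + Sᶜ.card = m * N + 1 := fun S => by
    have : S.card + Sᶜ.card = m * N + 1 := by rw [Finset.card_add_card_compl]; simp
    exact_mod_cast this
  constructor
  · rintro ⟨-, h⟩ X x
    have : hf.toMultilinearMap.compLinearMap (fun _ => weightMap K g V) =
        (weightMap K g V).compMultilinearMap hf.toMultilinearMap := by
      refine multilinearMap_ext_of_hasType fun S Z hZ => ?_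
      change hf.toMultilinearMap (fun o => weightMap K g V (Z o)) =
        weightMap K g V (hf.toMultilinearMap Z)
      rw [map_weightMap_of_hasType _ hZ, weightMap_apply]
      obtain ⟨h1, h2, h3⟩ := h S _ _ (hasType_iff.mpr hZ)
      change (_ → (hf.toMultilinearMap Z).2 = 0) at h1
      change (_ → (hf.toMultilinearMap Z).1 = 0) at h2
      change (_ → _ → hf.toMultilinearMap Z = 0) at h3
      have hS := hcard S
      by_cases c0 : Sᶜ.card = 0
      · have := h1 ⟨by omega, by omega⟩
        rw [c0, pow_zero, one_smul, this]
        exact Prod.ext rfl (by simp [this])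
      · by_cases c1 : Sᶜ.card = 1
        · have := h2 ⟨by omega, by omega⟩
          rw [c1, pow_one]
          exact Prod.ext (by simp [this]) rfl
        · rw [h3 (by omega) (by omega), smul_zero]
          exact Prod.ext rfl (smul_zero _).symm
    have h' := congrArg (fun M => M fun o => Option.elim o x fun ia => X ia.1 ia.2) this
    exact h'
  · intro h
    refine ⟨by simp, fun S X x hS => ?_⟩
    have h1 := map_weightMap_of_hasType hf.toMultilinearMap hS
    have h2 : (2 : K) ^ Sᶜ.card • f X x = weightMap K g V (f X x) := h1.symm.trans (h X x)
    rw [weightMap_apply] at h2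
    have e1 : (2 : K) ^ Sᶜ.card • (f X x).1 = (f X x).1 := congrArg Prod.fst h2
    have e2 : (2 : K) ^ Sᶜ.card • (f X x).2 = (2 : K) • (f X x).2 := congrArg Prod.snd h2
    have hinj : ∀ a b : ℕ, a ≠ b → ((2 : K) ^ a ≠ 2 ^ b) := fun a b hab h => hab
      (Nat.pow_right_injective le_rfl (by exact_mod_cast h))
    have z1 : Sᶜ.card ≠ 0 → (f X x).1 = 0 := fun hc => by
      have : ((2 : K) ^ Sᶜ.card - 2 ^ 0) • (f X x).1 = 0 := by
        rw [sub_smul, e1, pow_zero, one_smul, sub_self]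
      exact (smul_eq_zero.mp this).resolve_left (sub_ne_zero.mpr (hinj _ _ hc))
    have z2 : Sᶜ.card ≠ 1 → (f X x).2 = 0 := fun hc => by
      have : ((2 : K) ^ Sᶜ.card - 2 ^ 1) • (f X x).2 = 0 := by
        rw [sub_smul, e2, pow_one, sub_self]
      exact (smul_eq_zero.mp this).resolve_left (sub_ne_zero.mpr (hinj _ _ hc))
    have hS := hcard S
    refine ⟨fun hc => z2 (by omega), fun hc => z1 (by omega), fun hc hc' => Prod.ext (z1 ?_) (z2 ?_)⟩
    · intro h0
      exact hc ⟨by omega, by omega⟩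
    · intro h0
      exact hc' ⟨by omega, by omega⟩

theorem circLin_mem_bidegree [CharZero K] {P : Cochain K (g × V) N p} {Q : Cochain K (g × V) N q}
    (hP : P ∈ bidegreeSubmodule K g V N p) (hQ : Q ∈ bidegreeSubmodule K g V N q) :
    circLin K (g × V) N p q P Q ∈ bidegreeSubmodule K g V N (p + q) := by
  have h := (hasBidegree_iff (circLin K (g × V) N p q P Q).2.toIsBlockMultilinear).mpr
    (circ_map (weightMap K g V) ((hasBidegree_iff P.2.toIsBlockMultilinear).mp hP)
      ((hasBidegree_iff Q.2.toIsBlockMultilinear).mp hQ))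
  exact h

theorem bidegreeInclusion_lof (k : ℕ) (f : BidegreeCochain K g V N k) :
    bidegreeInclusion K g V N (DirectSum.lof K ℕ (fun k => BidegreeCochain K g V N k) k f) =
      DirectSum.lof K ℕ (fun k => Cochain K (g × V) N k) k f.1 :=
  DirectSum.lmap_lof _ _ _

theorem bidegreeInclusion_injective : Function.Injective (bidegreeInclusion K g V N) :=
  (DirectSum.lmap_injective _).mpr fun _ => Subtype.val_injective

theorem cast_mem_bidegree {m m' : ℕ} (h : m = m') {f : Cochain K (g × V) N m}
    (hf : f ∈ bidegreeSubmodule K g V N m) :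
    (h ▸ f : Cochain K (g × V) N m') ∈ bidegreeSubmodule K g V N m' := by
  subst h; exact hf

theorem exists_bracket_lof [CharZero K] (p q : ℕ) (P : BidegreeCochain K g V N p)
    (Q : BidegreeCochain K g V N q) : ∃ R : BidegreeCochain K g V N (p + q),
    nLieBracket K (g × V) N (DirectSum.lof K ℕ (fun k => Cochain K (g × V) N k) p P.1)
      (DirectSum.lof K ℕ (fun k => Cochain K (g × V) N k) q Q.1) =
    bidegreeInclusion K g V N
      (DirectSum.lof K ℕ (fun k => BidegreeCochain K g V N k) (p + q) R) := by
  let R : BidegreeCochain K g V N (p + q) := ⟨_, Submodule.sub_mem _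
    (circLin_mem_bidegree P.2 Q.2) (Submodule.smul_mem _ ((-1 : K) ^ (p * q))
      (cast_mem_bidegree (add_comm q p) (circLin_mem_bidegree Q.2 P.2)))⟩
  exact ⟨R, (nLieBracket_lof_eq_lof _ _).trans (bidegreeInclusion_lof (p + q) R).symm⟩

theorem exists_bracket [CharZero K] (α β : ⨁ k, BidegreeCochain K g V N k) :
    ∃ γ, bidegreeInclusion K g V N γ = nLieBracket K (g × V) N
      (bidegreeInclusion K g V N α) (bidegreeInclusion K g V N β) := by
  induction α using DirectSum.induction_on with
  | zero => exact ⟨0, by simp⟩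
  | add a b ha hb =>
    obtain ⟨c, hc⟩ := ha
    obtain ⟨d, hd⟩ := hb
    exact ⟨c + d, by simp [hc, hd]⟩
  | of p P =>
    induction β using DirectSum.induction_on with
    | zero => exact ⟨0, by simp⟩
    | add a b ha hb =>
      obtain ⟨c, hc⟩ := ha
      obtain ⟨d, hd⟩ := hb
      exact ⟨c + d, by simp [hc, hd]⟩
    | of q Q =>
      obtain ⟨R, hR⟩ := exists_bracket_lof p q P Q
      refine ⟨_, hR.symm.trans ?_⟩
      rw [← bidegreeInclusion_lof, ← bidegreeInclusion_lof]
      rfl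

theorem exists_bidegreeBracket [CharZero K] (N : ℕ) :
    ∃ br : (⨁ k, BidegreeCochain K g V N k) →ₗ[K] (⨁ k, BidegreeCochain K g V N k) →ₗ[K]
      ⨁ k, BidegreeCochain K g V N k,
      ∀ α β, bidegreeInclusion K g V N (br α β) = nLieBracket K (g × V) N
        (bidegreeInclusion K g V N α) (bidegreeInclusion K g V N β) := by
  choose b hb using exists_bracket (K := K) (g := g) (V := V) (N := N)
  refine ⟨LinearMap.mk₂ K b ?_ ?_ ?_ ?_, hb⟩
  · intro α α' β
    exact bidegreeInclusion_injective (by simp [hb])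
  · intro c α β
    exact bidegreeInclusion_injective (by simp [hb])
  · intro α β β'
    exact bidegreeInclusion_injective (by simp [hb])
  · intro c α β
    exact bidegreeInclusion_injective (by simp [hb])

theorem isGradedLieBracket_of_inclusion [CharZero K]
    {br : (⨁ k, BidegreeCochain K g V N k) →ₗ[K] (⨁ k, BidegreeCochain K g V N k) →ₗ[K]
      ⨁ k, BidegreeCochain K g V N k}
    (hbr : ∀ α β, bidegreeInclusion K g V N (br α β) = nLieBracket K (g × V) N
        (bidegreeInclusion K g V N α) (bidegreeInclusion K g V N β)) : IsGradedLieBracket br where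
  degree p q P Q := by
    obtain ⟨R, hR⟩ := exists_bracket_lof p q P Q
    exact ⟨R, bidegreeInclusion_injective (by
      rw [hbr, bidegreeInclusion_lof, bidegreeInclusion_lof, hR])⟩
  skew p q P Q := by
    apply bidegreeInclusion_injective
    rw [map_neg, map_smul, hbr, hbr, bidegreeInclusion_lof, bidegreeInclusion_lof]
    exact nLieBracket_isGradedLieBracket.skew p q P.1 Q.1
  jacobi p q s P Q R := by
    apply bidegreeInclusion_injective
    simp only [map_add, map_smul, hbr, bidegreeInclusion_lof]
    exact nLieBracket_isGradedLieBracket.jacobi p q s P.1 Q.1 R.1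

end BidegreeClosed

section PairEvaluation

variable {g V : Type*} [AddCommGroup V]

theorem update_inl {n : ℕ} (y : Fin n → g) (i : Fin n) (z : g) :
    Function.update (fun a => (y a, (0 : V))) i (z, 0) =
      fun a => (Function.update y i z a, 0) := by
  funext a
  by_cases h : a = i
  · subst h; simp
  · simp [h]

theorem snoc_inl {n : ℕ} (x : Fin n → g) (z : g) :
    (Fin.snoc (α := fun _ => g × V) (fun a => (x a, (0 : V))) (z, 0) : Fin (n + 1) → g × V) =
      fun i => (Fin.snoc (α := fun _ => g) x z i, 0) := by
  funext i
  refine Fin.lastCases ?_ (fun a => ?_) i <;> simp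

variable {K : Type*} [Field K] [AddCommGroup g] [Module K g] [Module K V]
  {r : ℕ} (μ : g [⋀^Fin (r + 2)]→ₗ[K] g) (ρ : g [⋀^Fin (r + 1)]→ₗ[K] Module.End K V)

theorem liftFun_inl (z : Fin (r + 2) → g) :
    liftFun μ ρ (fun i => (z i, (0 : V))) = (μ z, 0) := by
  simp [liftFun]

theorem liftFun_update (z : Fin (r + 2) → g) (j : Fin (r + 2)) (u : V) :
    liftFun μ ρ (Function.update (fun i => (z i, (0 : V))) j (0, u)) =
      (0, (-1 : K) ^ (r + 1 - (j : ℕ)) • ρ (j.removeNth z) u) := by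
  refine Prod.ext (μ.map_coord_zero j (by simp)) ?_
  change ∑ i : Fin (r + 2), (-1 : K) ^ (r + 1 - (i : ℕ)) • ρ (i.removeNth fun k =>
    (Function.update (fun i => (z i, (0 : V))) j (0, u) k).1)
    (Function.update (fun i => (z i, (0 : V))) j (0, u) i).2 = _
  rw [Finset.sum_eq_single j]
  · rw [Function.update_self]
    congr 3
    funext k
    simp [Fin.removeNth]
  · intro i _ hij
    simp [hij]
  · simp

theorem snoc_inl_inr {n : ℕ} (x : Fin n → g) (u : V) :
    (Fin.snoc (α := fun _ => g × V) (fun a => (x a, (0 : V))) (0, u) : Fin (n + 1) → g × V) =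
      Function.update (fun i => (Fin.snoc (α := fun _ => g) x 0 i, 0)) (Fin.last n) (0, u) := by
  funext i
  refine Fin.lastCases ?_ (fun a => ?_) i
  · simp
  · simp [(Fin.castSucc_lt_last a).ne]

theorem liftFun_snoc_inl (x : Fin (r + 1) → g) (z : g) :
    liftFun μ ρ (Fin.snoc (α := fun _ => g × V) (fun a => (x a, (0 : V))) (z, 0)) =
      (μ (Fin.snoc (α := fun _ => g) x z), 0) := by
  rw [snoc_inl, liftFun_inl]

theorem liftFun_snoc_inr (x : Fin (r + 1) → g) (u : V) :
    liftFun μ ρ (Fin.snoc (α := fun _ => g × V) (fun a => (x a, (0 : V))) (0, u)) =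
      (0, ρ x u) := by
  rw [snoc_inl_inr, liftFun_update]
  simp [Fin.removeNth_last]

theorem liftFun_snoc_update (x : Fin (r + 1) → g) (i : Fin (r + 1)) (u : V) (z : g) :
    liftFun μ ρ (Fin.snoc (α := fun _ => g × V)
      (Function.update (fun a => (x a, (0 : V))) i (0, u)) (z, 0)) =
      (0, (-1 : K) ^ (r + 1 - (i : ℕ)) •
        ρ (i.castSucc.removeNth (Fin.snoc (α := fun _ => g) x z)) u) := by
  rw [Fin.snoc_update, snoc_inl, liftFun_update, Fin.val_castSucc]

theorem liftFun_snoc_snoc (x : Fin r → g) (u : V) (z : g) :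
    liftFun μ ρ (Fin.snoc (α := fun _ => g × V)
      (Fin.snoc (α := fun _ => g × V) (fun a => (x a, (0 : V))) (0, u)) (z, 0)) =
      (0, -ρ (Fin.snoc (α := fun _ => g) x z) u) := by
  rw [snoc_inl_inr, liftFun_snoc_update]
  have h : (Fin.last r).castSucc.removeNth (Fin.snoc (α := fun _ => g)
      (Fin.snoc (α := fun _ => g) x (0 : g)) z) = Fin.snoc (α := fun _ => g) x z := by
    funext i
    refine Fin.lastCases ?_ (fun a => ?_) i
    · simp [Fin.removeNth]
    · have : (Fin.last r).castSucc.succAbove a.castSucc = a.castSucc.castSucc :=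
        Fin.succAbove_castSucc_of_lt _ _ (Fin.castSucc_lt_last a)
      simp [Fin.removeNth, this]
  rw [h]
  simp

theorem circ_one_one {W : Type*} [AddCommGroup W] {N : ℕ} (P : (Fin 1 → Fin N → W) → W → W)
    (X : Fin 2 → Fin N → W) (x : W) :
    circ P P X x = ∑ i, P (fun _ => Function.update (X 1) i (P (fun _ => X 0) (X 1 i))) x -
      P (fun _ => X 0) (P (fun _ => X 1) x) + P (fun _ => X 1) (P (fun _ => X 0) x) := by
  have h0 : shuffles (1 + 1) 0 1 = {1} := by decide
  have h1 : shuffles (1 + 1) 1 1 = {1, Equiv.swap 0 1} := by decide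
  have hne : (1 : Equiv.Perm (Fin 2)) ≠ Equiv.swap 0 1 := by decide
  have hP : ∀ (Y Y' : Fin 1 → Fin N → W) (y y' : W), Y 0 = Y' 0 → y = y' → P Y y = P Y' y' := by
    rintro Y Y' y _ h rfl
    congr 1
    funext a
    rw [Subsingleton.elim a 0, h]
  simp only [circ]
  rw [h1, Finset.sum_pair hne]
  simp only [Fin.sum_univ_one, Fin.val_zero, h0, Finset.sum_singleton]
  trans (1 : ℤ) • ∑ i, P (fun _ => Function.update (X 1) i (P (fun _ => X 0) (X 1 i))) x +
    ((-1 : ℤ) • P (fun _ => X 0) (P (fun _ => X 1) x) +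
      (1 : ℤ) • P (fun _ => X 1) (P (fun _ => X 0) x))
  · refine congrArg₂ (· + ·) (congrArg₂ (· • ·) (by simp) (Finset.sum_congr rfl fun i _ => ?_))
      (congrArg₂ (· + ·) (congrArg₂ (· • ·) (by simp) (hP _ _ _ _ rfl (hP _ _ _ _ rfl rfl)))
        (congrArg₂ (· • ·) (by simp) (hP _ _ _ _ rfl (hP _ _ _ _ rfl rfl))))
    refine hP _ _ _ _ ?_ rfl
    rw [Function.update_self]
    exact congrArg (Function.update _ i) (hP _ _ _ _ rfl rfl)
  · rw [one_smul, one_smul, neg_one_smul, sub_eq_add_neg, add_assoc]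

/-- `circ P P` for `P = μ + ρ`. -/
theorem circ_pairCochain (X : Fin 2 → Fin (r + 1) → g × V) (x : g × V) :
    circ (pairCochain μ ρ).1 (pairCochain μ ρ).1 X x =
      ∑ i, liftFun μ ρ (Fin.snoc (α := fun _ => g × V) (Function.update (X 1) i
        (liftFun μ ρ (Fin.snoc (α := fun _ => g × V) (X 0) (X 1 i)))) x) -
      liftFun μ ρ (Fin.snoc (α := fun _ => g × V) (X 0)
        (liftFun μ ρ (Fin.snoc (α := fun _ => g × V) (X 1) x))) +
      liftFun μ ρ (Fin.snoc (α := fun _ => g × V) (X 1)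
        (liftFun μ ρ (Fin.snoc (α := fun _ => g × V) (X 0) x))) :=
  circ_one_one _ X x

theorem circ_pairCochain_inl (x : Fin (r + 1) → g) (y : Fin (r + 2) → g)
    {X : Fin 2 → Fin (r + 1) → g × V} (h0 : X 0 = fun a => (x a, 0))
    (h1 : X 1 = fun a => (Fin.init y a, 0)) :
    circ (pairCochain μ ρ).1 (pairCochain μ ρ).1 X (y (Fin.last _), 0) =
      (∑ i, μ (Function.update y i (μ (Fin.snoc (α := fun _ => g) x (y i)))) -
        μ (Fin.snoc (α := fun _ => g) x (μ y)), 0) := by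
  rw [circ_pairCochain, h0, h1]
  simp only [liftFun_snoc_inl, update_inl]
  rw [Fin.snoc_init_self, Fin.sum_univ_castSucc (n := r + 1)]
  refine Prod.ext ?_ ?_
  · simp only [Prod.fst_add, Prod.fst_sub, Prod.fst_sum]
    have e1 : ∀ i : Fin (r + 1), ∀ z : g, Function.update y i.castSucc z =
        Fin.snoc (α := fun _ => g) (Function.update (Fin.init y) i z) (y (Fin.last _)) := by
      intro i z
      rw [Fin.snoc_update, Fin.snoc_init_self]
    have e2 : ∀ z : g, Function.update y (Fin.last _) z =
        Fin.snoc (α := fun _ => g) (Fin.init y) z := by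
      intro z
      conv_lhs => rw [← Fin.snoc_init_self y, Fin.update_snoc_last]
    simp only [e1, e2, Fin.init]
    abel
  · simp [Prod.snd_sum]

theorem circ_pairCochain_inr (x y : Fin (r + 1) → g) (u : V)
    {X : Fin 2 → Fin (r + 1) → g × V} (h0 : X 0 = fun a => (x a, 0))
    (h1 : X 1 = fun a => (y a, 0)) :
    circ (pairCochain μ ρ).1 (pairCochain μ ρ).1 X (0, u) =
      (0, (∑ i, ρ (Function.update y i (μ (Fin.snoc (α := fun _ => g) x (y i)))) -
        (ρ x * ρ y - ρ y * ρ x)) u) := by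
  rw [circ_pairCochain, h0, h1]
  simp only [liftFun_snoc_inl, update_inl, liftFun_snoc_inr]
  refine Prod.ext ?_ ?_
  · simp [Prod.fst_sum]
  · simp only [Prod.snd_add, Prod.snd_sub, Prod.snd_sum, LinearMap.sub_apply,
      LinearMap.sum_apply, Module.End.mul_apply]
    abel

theorem circ_pairCochain_block (x : Fin r → g) (u : V) (y : Fin (r + 2) → g)
    {X : Fin 2 → Fin (r + 1) → g × V}
    (h0 : X 0 = Fin.snoc (α := fun _ => g × V) (fun a => (x a, 0)) (0, u))
    (h1 : X 1 = fun a => (Fin.init y a, 0)) :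
    circ (pairCochain μ ρ).1 (pairCochain μ ρ).1 X (y (Fin.last _), 0) =
      (0, (ρ (Fin.snoc (α := fun _ => g) x (μ y)) - ∑ i : Fin (r + 2), (-1 : K) ^ (r + 1 - (i : ℕ)) •
        (ρ (i.removeNth y) * ρ (Fin.snoc (α := fun _ => g) x (y i)))) u) := by
  rw [circ_pairCochain, h0, h1]
  simp only [liftFun_snoc_inl, liftFun_snoc_snoc, liftFun_snoc_update, liftFun_snoc_inr]
  rw [Fin.snoc_init_self, Fin.sum_univ_castSucc (n := r + 1)]
  refine Prod.ext ?_ ?_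
  · simp [Prod.fst_sum]
  · simp only [Prod.snd_add, Prod.snd_sub, Prod.snd_sum, LinearMap.sub_apply, LinearMap.add_apply,
      LinearMap.sum_apply, LinearMap.smul_apply, Module.End.mul_apply, Fin.removeNth_last,
      Fin.val_castSucc, Fin.val_last, Nat.sub_self, pow_zero, one_smul, map_neg, smul_neg,
      Finset.sum_neg_distrib, Fin.init]
    abel

end PairEvaluation

theorem lof_injective {K : Type*} [Field K] {L : ℕ → Type*} [∀ k, AddCommGroup (L k)]
    [∀ k, Module K (L k)] (k : ℕ) : Function.Injective (DirectSum.lof K ℕ L k) :=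
  DirectSum.of_injective k

section DegreeOne

variable {K g V : Type*} [Field K] [AddCommGroup g] [Module K g] [AddCommGroup V] [Module K V]
  {m N r : ℕ}

/-- A function of bidegree `m(n-1)|0` is determined by its values on arguments of which at most one
lies in `V` and the other ones in `g`. -/
theorem eq_zero_of_hasBidegree {f : (Fin m → Fin N → g × V) → g × V → g × V}
    (hf : IsBlockMultilinear K f) (hb : HasBidegree (m * N) 0 f)
    (h0 : ∀ (Y : Fin m → Fin N → g) (y : g), f (fun i a => (Y i a, 0)) (y, 0) = 0)
    (hn : ∀ (Y : Fin m → Fin N → g) (u : V), f (fun i a => (Y i a, 0)) (0, u) = 0)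
    (hs : ∀ (Y : Fin m → Fin N → g) (y : g) (i : Fin m) (a : Fin N) (u : V),
      f (Function.update (fun i a => (Y i a, 0)) i
        (Function.update (fun b => (Y i b, 0)) a (0, u))) (y, 0) = 0)
    (X : Fin m → Fin N → g × V) (x : g × V) : f X x = 0 := by
  have : hf.toMultilinearMap = 0 := by
    refine multilinearMap_ext_of_hasType fun S Z hZ => ?_
    change f (fun i a => Z (some (i, a))) (Z none) = 0
    have hS : (S.card : ℤ) + Sᶜ.card = m * N + 1 := by
      have : S.card + Sᶜ.card = m * N + 1 := by rw [Finset.card_add_card_compl]; simp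
      exact_mod_cast this
    have hg : ∀ o, o ∈ S → Z o = ((Z o).1, 0) := fun o ho => Prod.ext rfl ((hZ o).1 ho)
    by_cases c0 : Sᶜ.card = 0
    · have hS' : ∀ o, o ∈ S := fun o => by
        by_contra h
        have := Finset.card_eq_zero.mp c0
        rw [Finset.eq_empty_iff_forall_notMem] at this
        exact this o (Finset.mem_compl.mpr h)
      have := h0 (fun i a => (Z (some (i, a))).1) (Z none).1
      simpa only [← hg _ (hS' _)] using this
    · by_cases c1 : Sᶜ.card = 1
      · obtain ⟨o, ho⟩ := Finset.card_eq_one.mp c1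
        have hS' : ∀ o', o' ∈ S ↔ o' ≠ o := fun o' => by
          rw [← not_iff_not, ← Finset.mem_compl, ho, Finset.mem_singleton, not_not]
        have hv : Z o = (0, (Z o).2) :=
          Prod.ext ((hZ o).2 fun h => (hS' o).mp h rfl) rfl
        rcases o with _ | ⟨i, a⟩
        · have := hn (fun i a => (Z (some (i, a))).1) (Z none).2
          simpa only [← hg _ ((hS' (some _)).mpr (Option.some_ne_none _)), ← hv] using this
        · have := hs (fun i a => (Z (some (i, a))).1) (Z none).1 i a (Z (some (i, a))).2
          rw [← hv, ← hg none ((hS' none).mpr (Option.some_ne_none _).symm)] at this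
          convert this using 2
          funext j b
          by_cases hj : j = i
          · subst hj
            by_cases hba : b = a
            · subst hba; simp
            · simpa [hba] using hg (some (j, b)) ((hS' _).mpr (by simp [hba]))
          · simpa [hj] using hg (some (j, b)) ((hS' _).mpr (by simp [hj]))
      · exact (hb.2 S _ _ (hasType_iff.mpr hZ)).2.2 (by omega) (by omega)
  exact congrArg (fun M => M fun o => Option.elim o x fun ia => X ia.1 ia.2) this

/-- In the last block, a vector of `V` may be exchanged with the last vector. -/
theorem IsCochain.eq_zero_of_inr_last {f : (Fin m → Fin N → g × V) → g × V → g × V}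
    (hf : IsCochain K f)
    (hn : ∀ (Y : Fin m → Fin N → g) (u : V), f (fun i a => (Y i a, 0)) (0, u) = 0)
    (Y : Fin m → Fin N → g) (y : g) (i : Fin m) (hi : (i : ℕ) + 1 = m) (a : Fin N) (u : V) :
    f (Function.update (fun i a => (Y i a, 0)) i
      (Function.update (fun b => (Y i b, 0)) a (0, u))) (y, 0) = 0 := by
  have h := hf.swap_last (fun i a => (Y i a, 0)) i hi a (0, u) (y, 0)
  have e : Function.update (fun i a => (Y i a, (0 : V))) i
      (Function.update (fun b => (Y i b, 0)) a (y, 0)) =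
      fun j b => (Function.update Y i (Function.update (Y i) a y) j b, 0) := by
    rw [update_inl]
    funext j b
    by_cases hj : j = i
    · subst hj; simp
    · simp [hj]
  rw [e, hn, add_zero] at h
  exact h

theorem eq_zero_of_degree_one {f : (Fin 1 → Fin N → g × V) → g × V → g × V}
    (hf : IsCochain K f) (hb : HasBidegree ((1 : ℕ) * N) 0 f)
    (h0 : ∀ (Y : Fin 1 → Fin N → g) (y : g), f (fun i a => (Y i a, 0)) (y, 0) = 0)
    (hn : ∀ (Y : Fin 1 → Fin N → g) (u : V), f (fun i a => (Y i a, 0)) (0, u) = 0)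
    (X : Fin 1 → Fin N → g × V) (x : g × V) : f X x = 0 :=
  eq_zero_of_hasBidegree hf.toIsBlockMultilinear hb h0 hn
    (fun Y y i a u => hf.eq_zero_of_inr_last hn Y y i (by omega) a u) X x

theorem eq_zero_of_degree_two {f : (Fin 2 → Fin (r + 1) → g × V) → g × V → g × V}
    (hf : IsCochain K f) (hb : HasBidegree ((2 : ℕ) * (r + 1 : ℕ)) 0 f)
    (h0 : ∀ (Y : Fin 2 → Fin (r + 1) → g) (y : g), f (fun i a => (Y i a, 0)) (y, 0) = 0)
    (hn : ∀ (Y : Fin 2 → Fin (r + 1) → g) (u : V), f (fun i a => (Y i a, 0)) (0, u) = 0)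
    (hs : ∀ (Y : Fin 2 → Fin (r + 1) → g) (x : Fin r → g) (u : V) (y : g),
      f (Function.update (fun i a => (Y i a, 0)) 0
        (Fin.snoc (α := fun _ => g × V) (fun a => (x a, 0)) (0, u))) (y, 0) = 0)
    (X : Fin 2 → Fin (r + 1) → g × V) (x : g × V) : f X x = 0 := by
  refine eq_zero_of_hasBidegree hf.toIsBlockMultilinear hb h0 hn (fun Y y i a u => ?_) X x
  by_cases hi : i = 1
  · subst hi
    exact hf.eq_zero_of_inr_last hn Y y 1 rfl a u
  · have hi0 : i = 0 := by omega
    subst hi0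
    have hlast : ∀ B : Fin (r + 1) → g, Function.update (fun b => (B b, (0 : V))) (Fin.last r) (0, u) =
        Fin.snoc (α := fun _ => g × V) (fun a => (Fin.init B a, 0)) (0, u) := by
      intro B
      funext b
      refine Fin.lastCases ?_ (fun c => ?_) b
      · simp
      · simp [(Fin.castSucc_lt_last c).ne, Fin.init]
    by_cases ha : a = Fin.last r
    · subst ha
      rw [hlast]
      exact hs _ _ _ _
    · have h := hf.swap_block (fun i a => (Y i a, 0)) (y, 0) 0 ha (fun b => (Y 0 b, 0)) (0, u)
        (Y 0 (Fin.last r), 0)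
      have e : Function.update (Function.update (fun b => (Y 0 b, (0 : V))) a (0, u)) (Fin.last r)
          (Y 0 (Fin.last r), 0) = Function.update (fun b => (Y 0 b, (0 : V))) a (0, u) := by
        rw [Function.update_comm ha]
        congr 1
        exact Function.update_eq_self _ _
      rw [e, update_inl, hlast, hs, add_zero] at h
      exact h

theorem pairCochain_inl (μ : g [⋀^Fin (r + 2)]→ₗ[K] g) (ρ : g [⋀^Fin (r + 1)]→ₗ[K] Module.End K V)
    (Y : Fin 1 → Fin (r + 1) → g) (y : g) :
    (pairCochain μ ρ).1 (fun i a => (Y i a, 0)) (y, 0) =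
      (μ (Fin.snoc (α := fun _ => g) (Y 0) y), 0) :=
  liftFun_snoc_inl μ ρ (Y 0) y

theorem pairCochain_inr (μ : g [⋀^Fin (r + 2)]→ₗ[K] g) (ρ : g [⋀^Fin (r + 1)]→ₗ[K] Module.End K V)
    (Y : Fin 1 → Fin (r + 1) → g) (u : V) :
    (pairCochain μ ρ).1 (fun i a => (Y i a, 0)) (0, u) = (0, ρ (Y 0) u) :=
  liftFun_snoc_inr μ ρ (Y 0) u

theorem pairCochain_injective {μ μ' : g [⋀^Fin (r + 2)]→ₗ[K] g}
    {ρ ρ' : g [⋀^Fin (r + 1)]→ₗ[K] Module.End K V} (h : pairCochain μ ρ = pairCochain μ' ρ') :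
    μ = μ' ∧ ρ = ρ' := by
  constructor
  · ext z
    have h1 := pairCochain_inl μ ρ (fun _ => Fin.init z) (z (Fin.last _))
    rw [h, pairCochain_inl, Fin.snoc_init_self] at h1
    exact (congrArg Prod.fst h1).symm
  · ext z u
    have h1 := pairCochain_inr μ ρ (fun _ => z) u
    rw [h, pairCochain_inr] at h1
    exact (congrArg Prod.snd h1).symm

/-- Cochains of degree `1` are alternating maps. -/
theorem IsCochain.exists_alternatingMap {W : Type*} [AddCommGroup W] [Module K W]
    {f : (Fin 1 → Fin N → W) → W → W} (hf : IsCochain K f) :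
    ∃ φ : W [⋀^Fin (N + 1)]→ₗ[K] W, ∀ w, φ w = f (fun _ => Fin.init w) (w (Fin.last N)) := by
  have hupd : ∀ (w : Fin (N + 1) → W) (a : Fin N) (u : W),
      (fun _ : Fin 1 => Fin.init (Function.update w a.castSucc u)) =
      Function.update (fun _ => Fin.init w) 0 (Function.update (Fin.init w) a u) := by
    intro w a u
    funext i
    rw [Subsingleton.elim i 0, Function.update_self, Fin.init_update_castSucc]
  have hupd' : ∀ (w : Fin (N + 1) → W) (a : Fin N) (u : W),
      Function.update w a.castSucc u (Fin.last N) = w (Fin.last N) := fun w a u =>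
    Function.update_of_ne (Fin.castSucc_lt_last a).ne' _ _
  refine ⟨{ toFun := fun w => f (fun _ => Fin.init w) (w (Fin.last N))
            map_update_add' := ?_, map_update_smul' := ?_, map_eq_zero_of_eq' := ?_ },
    fun w => rfl⟩
  · intro inst w j u v
    obtain rfl : inst = instDecidableEqFin _ := Subsingleton.elim _ _
    refine Fin.lastCases ?_ (fun a => ?_) j
    · simp only [Fin.init_update_last, Function.update_self]
      exact (hf.linear_last _).map_add u v
    · simp only [hupd, hupd']
      exact (hf.linear_block (fun _ => Fin.init w) _ 0 a).map_add u v
  · intro inst w j c u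
    obtain rfl : inst = instDecidableEqFin _ := Subsingleton.elim _ _
    refine Fin.lastCases ?_ (fun a => ?_) j
    · simp only [Fin.init_update_last, Function.update_self]
      exact (hf.linear_last _).map_smul c u
    · simp only [hupd, hupd']
      exact (hf.linear_block (fun _ => Fin.init w) _ 0 a).map_smul c u
  · intro w i j
    refine Fin.lastCases ?_ (fun a => ?_) i <;> refine Fin.lastCases ?_ (fun b => ?_) j
    · intro _ h; exact absurd rfl h
    · intro h _
      exact hf.alt_last _ _ 0 b rfl h.symm
    · intro h _
      exact hf.alt_last _ _ 0 a rfl h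
    · intro h hab
      exact hf.alt_block _ _ 0 a b (fun e => hab (congrArg _ e)) h

theorem exists_pairCochain_eq [CharZero K] (f : Cochain K (g × V) (r + 1) 1)
    (hb : f ∈ bidegreeSubmodule K g V (r + 1) 1) :
    ∃ (μ : g [⋀^Fin (r + 2)]→ₗ[K] g) (ρ : g [⋀^Fin (r + 1)]→ₗ[K] Module.End K V),
      f = pairCochain μ ρ := by
  have hf : IsCochain K f.1 := f.2
  have hw := (hasBidegree_iff hf.toIsBlockMultilinear).mp hb
  have hc : ∀ Y : Fin 1 → Fin (r + 1) → g, (fun i a => (Y i a, (0 : V))) =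
      fun _ a => (Y 0 a, 0) := fun Y => by
    funext i a; rw [Subsingleton.elim i 0]
  obtain ⟨φ, hφ⟩ := hf.exists_alternatingMap
  let μ : g [⋀^Fin (r + 2)]→ₗ[K] g :=
    (LinearMap.fst K g V).compAlternatingMap (φ.compLinearMap (LinearMap.inl K g V))
  have hupd : ∀ (x : Fin (r + 1) → g) (i : Fin (r + 1)) (z : g),
      (fun (_ : Fin 1) a => (Function.update x i z a, (0 : V))) =
      Function.update (fun _ a => (x a, 0)) 0 (Function.update (fun a => (x a, 0)) i (z, 0)) := by
    intro x i z
    funext j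
    rw [Subsingleton.elim j 0, Function.update_self, update_inl]
  let ρ : g [⋀^Fin (r + 1)]→ₗ[K] Module.End K V :=
    { toFun := fun x =>
        { toFun := fun u => (f.1 (fun _ a => (x a, 0)) (0, u)).2
          map_add' := fun u v => by
            have := (hf.linear_last fun _ a => (x a, (0 : V))).map_add (0, u) (0, v)
            rw [Prod.mk_add_mk, add_zero] at this
            rw [this]; rfl
          map_smul' := fun c u => by
            have := (hf.linear_last fun _ a => (x a, (0 : V))).map_smul c (0, u)
            rw [Prod.smul_mk, smul_zero] at this
            rw [this]; rfl }
      map_update_add' := by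
        intro inst x i z z'
        obtain rfl : inst = instDecidableEqFin _ := Subsingleton.elim _ _
        ext u
        have := (hf.linear_block (fun _ a => (x a, (0 : V))) (0, u) 0 i).map_add (z, 0) (z', 0)
        rw [Prod.mk_add_mk, add_zero] at this
        simp only [LinearMap.coe_mk, AddHom.coe_mk, hupd, LinearMap.add_apply]
        rw [this]; rfl
      map_update_smul' := by
        intro inst x i c z
        obtain rfl : inst = instDecidableEqFin _ := Subsingleton.elim _ _
        ext u
        have := (hf.linear_block (fun _ a => (x a, (0 : V))) (0, u) 0 i).map_smul c (z, 0)
        rw [Prod.smul_mk, smul_zero] at this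
        simp only [LinearMap.coe_mk, AddHom.coe_mk, hupd, LinearMap.smul_apply]
        rw [this]; rfl
      map_eq_zero_of_eq' := by
        intro x i j hij hne
        ext u
        have := hf.alt_block (fun _ a => (x a, (0 : V))) (0, u) 0 i j hne
          (Prod.ext hij rfl)
        simp only [LinearMap.coe_mk, AddHom.coe_mk, this]
        rfl }
  refine ⟨μ, ρ, ?_⟩
  have hd : f - pairCochain μ ρ ∈ bidegreeSubmodule K g V (r + 1) 1 :=
    Submodule.sub_mem _ hb (pairCochain_mem μ ρ)
  have hinl : ∀ (Y : Fin 1 → Fin (r + 1) → g) (y : g), f.1 (fun i a => (Y i a, 0)) (y, 0) =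
      (pairCochain μ ρ).1 (fun i a => (Y i a, 0)) (y, 0) := by
    intro Y y
    rw [pairCochain_inl]
    refine Prod.ext ?_ ?_
    · change _ = (φ fun i => ((Fin.snoc (α := fun _ => g) (Y 0) y : Fin (r + 2) → g) i, (0 : V))).1
      rw [hφ, hc, Fin.snoc_last]
      refine congrArg (fun X => (f.1 X (y, 0)).1) ?_
      funext i a
      simp [Fin.init]
    · have := congrArg Prod.snd (hw (fun i a => (Y i a, 0)) (y, 0))
      simp only [weightMap_apply, smul_zero, two_smul] at this
      simpa using this
  have hinr : ∀ (Y : Fin 1 → Fin (r + 1) → g) (u : V), f.1 (fun i a => (Y i a, 0)) (0, u) =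
      (pairCochain μ ρ).1 (fun i a => (Y i a, 0)) (0, u) := by
    intro Y u
    rw [pairCochain_inr]
    refine Prod.ext ?_ ?_
    · have h1 := congrArg Prod.fst (hw (fun i a => (Y i a, 0)) (0, u))
      have h2 := (hf.linear_last fun i a => (Y i a, (0 : V))).map_smul (2 : K) (0, u)
      simp only [weightMap_apply, smul_zero] at h1
      rw [Prod.smul_mk, smul_zero] at h2
      rw [h2, Prod.smul_fst, two_smul] at h1
      simpa using h1
    · rw [hc]; rfl
  refine sub_eq_zero.mp (Subtype.ext ?_)
  funext X x
  refine eq_zero_of_degree_one (f - pairCochain μ ρ).2 hd (fun Y y => ?_) (fun Y u => ?_) X x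
  · exact sub_eq_zero.mpr (hinl Y y)
  · exact sub_eq_zero.mpr (hinr Y u)

end DegreeOne

section MaurerCartan

variable {K g V : Type*} [Field K] [CharZero K] [AddCommGroup g] [Module K g] [AddCommGroup V]
  [Module K V] {r : ℕ}

theorem circ_pairCochain_eq_zero_iff (μ : g [⋀^Fin (r + 2)]→ₗ[K] g)
    (ρ : g [⋀^Fin (r + 1)]→ₗ[K] Module.End K V) :
    (∀ X x, circ (pairCochain μ ρ).1 (pairCochain μ ρ).1 X x = 0) ↔
      IsNLieAlgebra μ ∧ IsNLieRepresentation μ ρ := by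
  constructor
  · intro h
    refine ⟨fun x y => ?_, fun x y => ?_, fun x y => ?_⟩
    · have := h ![fun a => (x a, 0), fun a => (Fin.init y a, 0)] (y (Fin.last _), 0)
      rw [circ_pairCochain_inl μ ρ x y rfl rfl] at this
      exact (sub_eq_zero.mp (congrArg Prod.fst this)).symm
    · ext u
      have := h ![fun a => (x a, 0), fun a => (y a, 0)] (0, u)
      rw [circ_pairCochain_inr μ ρ x y u rfl rfl, LinearMap.sub_apply] at this
      exact (sub_eq_zero.mp (congrArg Prod.snd this)).symm
    · ext u
      have := h ![Fin.snoc (α := fun _ => g × V) (fun a => (x a, 0)) (0, u),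
        fun a => (Fin.init y a, 0)] (y (Fin.last _), 0)
      rw [circ_pairCochain_block μ ρ x u y rfl rfl, LinearMap.sub_apply] at this
      exact sub_eq_zero.mp (congrArg Prod.snd this)
  · rintro ⟨hμ, hρ⟩ X x
    have hmem := circLin_mem_bidegree (pairCochain_mem μ ρ) (pairCochain_mem μ ρ)
    refine eq_zero_of_degree_two (circLin K (g × V) (r + 1) 1 1 (pairCochain μ ρ)
      (pairCochain μ ρ)).2 hmem (fun Y y => ?_) (fun Y u => ?_) (fun Y x u y => ?_) X x
    · have := circ_pairCochain_inl μ ρ (Y 0) (Fin.snoc (α := fun _ => g) (Y 1) y)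
        (X := fun i a => (Y i a, 0)) rfl (by rw [Fin.init_snoc])
      rw [Fin.snoc_last, hμ, sub_self] at this
      exact this
    · have := circ_pairCochain_inr μ ρ (Y 0) (Y 1) u (X := fun i a => (Y i a, 0)) rfl rfl
      rw [hρ.commutator, sub_self] at this
      exact this
    · have := circ_pairCochain_block μ ρ x u (Fin.snoc (α := fun _ => g) (Y 1) y)
        (X := Function.update (fun i a => (Y i a, 0)) 0
          (Fin.snoc (α := fun _ => g × V) (fun a => (x a, 0)) (0, u)))
        (Function.update_self _ _ _)
        (by rw [Function.update_of_ne (by decide), Fin.init_snoc])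
      rw [Fin.snoc_last, hρ.bracket, sub_self] at this
      exact this

theorem isMaurerCartan_pairElement_iff
    {br : (⨁ k, BidegreeCochain K g V (r + 1) k) →ₗ[K] (⨁ k, BidegreeCochain K g V (r + 1) k) →ₗ[K]
      ⨁ k, BidegreeCochain K g V (r + 1) k}
    (hbr : ∀ α β, bidegreeInclusion K g V (r + 1) (br α β) = nLieBracket K (g × V) (r + 1)
        (bidegreeInclusion K g V (r + 1) α) (bidegreeInclusion K g V (r + 1) β))
    (μ : g [⋀^Fin (r + 2)]→ₗ[K] g) (ρ : g [⋀^Fin (r + 1)]→ₗ[K] Module.End K V) :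
    IsMaurerCartan br (pairElement μ ρ) ↔ IsNLieAlgebra μ ∧ IsNLieRepresentation μ ρ := by
  rw [← circ_pairCochain_eq_zero_iff]
  have h1 : bidegreeInclusion K g V (r + 1) (br (pairElement μ ρ) (pairElement μ ρ)) =
      (2 : K) • DirectSum.lof K ℕ (fun m => Cochain K (g × V) (r + 1) m) 2
        (circLin K (g × V) (r + 1) 1 1 (pairCochain μ ρ) (pairCochain μ ρ)) := by
    have h : bidegreeInclusion K g V (r + 1) (pairElement μ ρ) =
        DirectSum.lof K ℕ (fun m => Cochain K (g × V) (r + 1) m) 1 (pairCochain μ ρ) :=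
      bidegreeInclusion_lof 1 ⟨pairCochain μ ρ, pairCochain_mem μ ρ⟩
    rw [hbr, h, nLieBracket_lof, mul_one, pow_one, neg_one_smul, sub_neg_eq_add, two_smul]
  have h2 : IsMaurerCartan br (pairElement μ ρ) ↔ br (pairElement μ ρ) (pairElement μ ρ) = 0 :=
    ⟨fun h => h.2, fun h => ⟨⟨_, rfl⟩, h⟩⟩
  rw [h2, ← map_eq_zero_iff _ bidegreeInclusion_injective, h1,
    smul_eq_zero_iff_right two_ne_zero]
  refine (map_eq_zero_iff _ (lof_injective 2)).trans ?_
  constructor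
  · intro h X x
    exact congrFun (congrFun (congrArg Subtype.val h) X) x
  · intro h
    refine Subtype.ext ?_
    funext X x
    exact h X x

theorem existsUnique_pairElement_eq (a : BidegreeCochain K g V (r + 1) 1) :
    ∃! μρ : (g [⋀^Fin (r + 2)]→ₗ[K] g) × (g [⋀^Fin (r + 1)]→ₗ[K] Module.End K V),
      DirectSum.lof K ℕ (fun k => BidegreeCochain K g V (r + 1) k) 1 a =
        pairElement μρ.1 μρ.2 := by
  obtain ⟨μ, ρ, h⟩ := exists_pairCochain_eq a.1 a.2
  refine ⟨(μ, ρ), ?_, ?_⟩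
  · exact congrArg _ (Subtype.ext h)
  · rintro ⟨μ', ρ'⟩ h'
    have h1 := congrArg Subtype.val (lof_injective 1 h')
    obtain ⟨rfl, rfl⟩ := pairCochain_injective (h1.symm.trans h)
    rfl

end MaurerCartan

end NLie

theorem mainTheorem12 {K g V : Type*} [Field K] [CharZero K] [AddCommGroup g] [Module K g]
    [AddCommGroup V] [Module K V] (r : ℕ) :
    NLie.IsGradedLieBracket (NLie.nLieBracket K (g × V) (r + 1)) ∧
    ∃ br : (⨁ k, NLie.BidegreeCochain K g V (r + 1) k) →ₗ[K]
        (⨁ k, NLie.BidegreeCochain K g V (r + 1) k) →ₗ[K] ⨁ k, NLie.BidegreeCochain K g V (r + 1) k,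
      (∀ α β, NLie.bidegreeInclusion K g V (r + 1) (br α β) =
        NLie.nLieBracket K (g × V) (r + 1) (NLie.bidegreeInclusion K g V (r + 1) α)
          (NLie.bidegreeInclusion K g V (r + 1) β)) ∧
      NLie.IsGradedLieBracket br ∧
      (∀ (μ : g [⋀^Fin (r + 2)]→ₗ[K] g) (ρ : g [⋀^Fin (r + 1)]→ₗ[K] Module.End K V),
        NLie.IsMaurerCartan br (NLie.pairElement μ ρ) ↔
          NLie.IsNLieAlgebra μ ∧ NLie.IsNLieRepresentation μ ρ) ∧
      (∀ α, NLie.IsMaurerCartan br α →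
        ∃! μρ : (g [⋀^Fin (r + 2)]→ₗ[K] g) × (g [⋀^Fin (r + 1)]→ₗ[K] Module.End K V),
          α = NLie.pairElement μρ.1 μρ.2) := by
  obtain ⟨br, hbr⟩ := NLie.exists_bidegreeBracket (K := K) (g := g) (V := V) (r + 1)
  refine ⟨NLie.nLieBracket_isGradedLieBracket, br, hbr,
    NLie.isGradedLieBracket_of_inclusion hbr, NLie.isMaurerCartan_pairElement_iff hbr, ?_⟩
  rintro _ ⟨⟨a, rfl⟩, -⟩
  exact NLie.existsUnique_pairElement_eq a
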